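/- **Setting.** Let $X=\prod_{i=1}^{n_x}[x_{i,\min},x_{i,\max}]$, $A=\prod_{i=1}^{n_a}[a_{i,\min},a_{i,\max}]$, $\mathbb K=X\times A$. Let $Q(\cdot|x,a)$ be a Markov kernel from $\mathbb K$ to $X$ that is Lipschitz in total variation with respect to $\|\cdot\|_2$, let $\varphi=(\varphi_1,\dots,\varphi_{n_\ell})$ be Lipschitz functions on $\mathbb K$, $\bar\ell=\bar\theta_\ell^T\varphi$, and $\alpha\in(0,1)$. For a (randomized, history-dependent) policy $\boldsymbol\pi$ and an initial distribution $\mu$ put $J(\boldsymbol\pi;\mu)=\mathbb E\sum_{t\ge1}\alpha^{t-1}\bar\ell(\boldsymbol x_t,\boldsymbol a_t)$, and let $\bar V(x)=\inf_{\boldsymbol\pi}J(\boldsymbol\pi;\delta_x)$. Write $(q^*V)(x,a)=\int V\,dQ(\cdot|x,a)$, $(\mathscr P^*V)(x,a)=V(x)$ and $\bar\psi=\bar\ell+\alpha q^*\bar V-\mathscr P^*\bar V$; assume $\int_{\mathbb K}\bar\psi\,dx\,da\ge1$. Let $\mu_1$ be a probability measure with support $X$, and let the expert use a deterministic stationary policy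 given by a measurable $\bar\pi:X\to A$ that minimizes $J(\cdot;\mu_1)$ over all policies. Let $(\boldsymbol x_t^i,\boldsymbol a_t^i)_{t=1}^N$, $i=1,2,\dots$, be i.i.d. copies of the first $N$ steps of the process under $\bar\pi$ started from $\mu_1$. Let $\hat\mu^{\bar\pi,N}=\sum_{t=1}^N\mu_t^{\bar\pi}$, where $\mu_t^{\bar\pi}$ is the law of $(\boldsymbol x_t,\boldsymbol a_t)$ under $\bar\pi$, and let $\mathscr P\mu$ be the marginal on $X$ of a measure $\mu$ on $\mathbb K$. **The estimator.** For $\mathbf d=(d_\psi,d_V)$ let $r=(r_j)$ be a basis (depending on $d_V$) of the polynomials of degree $\le 2d_V$ in $x$, let $\phi=(\phi_k)$ be the Lagrange basis of the polynomials of degree $\le2d_\psi$ in $(x,a)$ for nodes $\eta_{[k]}\in\mathbb K$, and let $\gamma_i^T\phi$ be a polynomial approximation of $\varphi_i$. Assume that, for every fixed $d_V$, as $d_\psi\to\infty$, $\gamma_i^T\phi\to\varphi_i$ and the interpolants $\sum_k(q^*r_j)(\eta_{[k]})\phi_k\to q^*r_j$ uniformly on $\mathbb K$, for all $i,j$. Let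 $\mathscr Q$ be the quadratic module $\{u_0+\sum_iu_ig_i: u_0,u_i \text{ sums of squares of polynomials}\}$ generated by the polynomials $g_i=(y_i-y_{i,\min})(y_{i,\max}-y_i)$, with $y=(x,a)$. Consider $$\min_{\theta_\psi,\theta_\ell,\theta_V}\ \frac1M\sum_{i=1}^M\sum_{t=1}^N\theta_\psi^T\phi(\boldsymbol x_t^i,\boldsymbol a_t^i)\qquad(\mathrm E)$$ subject to $\theta_{\psi,k}=\sum_i\theta_{\ell,i}\gamma_{i,k}+\sum_j\theta_{V,j}\,(\alpha q^*r_j-\mathscr P^*r_j)(\eta_{[k]})$ for all $k$, $\ \theta_\psi^T\phi\in\mathscr Q$, $\ \int_{\mathbb K}\theta_\psi^T\phi\,dx\,da\ge1$, $\ \|\theta_\psi\|_\infty^2\le\beta'_\psi$, $\ \|\theta_\ell\|_\infty^2\le\beta'_\ell$, $\ \|\theta_V\|_\infty^2\le\beta'_V(d_V)$. From a solution form $\hat\psi_{M,\mathbf d}$, which may be either the polynomial $\theta_\psi^T\phi$ or the function $\theta_\ell^T\varphi+(\alpha q^*-\mathscr P^*)(\theta_V^Tr)$. Let $\Theta\subset\mathbb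 R^p$ be compact and $\pi(\cdot;\theta):X\to A$, $\theta\in\Theta$, measurable functions such that $\pi(x;\cdot)$ is continuous on $\Theta$ for every $x$ and $\bar\pi=\pi(\cdot;\theta_{\bar\pi})$ for some $\theta_{\bar\pi}\in\Theta$. Let $\hat\pi_{M,\mathbf d}=\pi(\cdot;\hat\theta)$ with $\hat\theta$ a minimizer of $$\min_{\theta\in\Theta}\ \frac1M\sum_{t=1}^N\sum_{i=1}^M\Big[\hat\psi_{M,\mathbf d}(\boldsymbol x_t^i,\pi(\boldsymbol x_t^i;\theta))+\|\boldsymbol a_t^i-\pi(\boldsymbol x_t^i;\theta)\|_2^2\Big].\qquad(\mathrm P)$$ **Corollary 4.8.** If the bounds are large enough ($\beta'_\psi\ge b_\psi$, $\beta'_\ell\ge b_\ell$, $\beta'_V(d_V)\ge b_V(d_V)$ for all $d_V$, with thresholds that depend only on the control model, $\mu_1$, $\bar\pi$ and the bases $r$), then $$\lim_{M\to\infty}\lim_{d_V\to\infty}\lim_{d_\psi\to\infty}\big\langle\|\hat\pi_{M,\mathbf d}-\bar\pi\|_2^2,\ \mathscr P\hat\mu^{\bar\pi,N}\big\rangle=0\qquad\text{a.s.}$$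 in the following sense: almost surely, for every $\varepsilon>0$ there is $M'$ such that for each $M\ge M'$ there is $d_V'$ such that for each $d_V\ge d_V'$ there is $d_\psi'$ such that for all $d_\psi\ge d_\psi'$ problem $(\mathrm E)$ is feasible and $\langle\|\hat\pi_{M,\mathbf d}-\bar\pi\|_2^2,\mathscr P\hat\mu^{\bar\pi,N}\rangle\le\varepsilon$, whichever minimizers of $(\mathrm E)$ and $(\mathrm P)$ are chosen. More generally, for some $\tau>0$ depending on $\varepsilon$ (and the realization), this holds for all minimizers up to the tolerance $\tau$ (feasible points whose objective value is within $\tau$ of the infimum) in place of exact minimizers in $(\mathrm E)$ and $(\mathrm P)$. -/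

import Mathlib

open MeasureTheory ProbabilityTheory Filter
open scoped ENNReal NNReal

namespace IOC

noncomputable section

/-! ### Elementary notions -/

/-- The squared Euclidean distance `‖u - v‖₂²` of two vectors. -/
def sqDist {n : ℕ} (u v : Fin n → ℝ) : ℝ := ∑ i, (u i - v i) ^ 2

/-- The Euclidean distance of two state-action pairs. -/
def pairDist {n m : ℕ} (x y : Fin n → ℝ) (a b : Fin m → ℝ) : ℝ :=
  Real.sqrt (sqDist x y + sqDist a b)

/-- The total variation norm of `μ - ν`, i.e. the supremum of `∫ v dμ - ∫ v dν` over all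
measurable `v` with `|v| ≤ 1`. -/
def tvDist {S : Type*} [MeasurableSpace S] (μ ν : Measure S) : ℝ :=
  ⨆ v : {v : S → ℝ // Measurable v ∧ ∀ s, |v s| ≤ 1}, (∫ s, v.1 s ∂μ - ∫ s, v.1 s ∂ν)

/-- `z` minimizes `f` over `F` up to the tolerance `τ`; for `τ = 0` it is an exact minimizer. -/
def IsMinimizerUpTo {Z : Type*} (τ : ℝ) (f : Z → ℝ) (F : Set Z) (z : Z) : Prop :=
  z ∈ F ∧ ∀ w ∈ F, f z ≤ f w + τ

/-! ### The control model -/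

/-- A discounted Markov control model whose state space `X` and action space `A` are boxes, with
every action feasible in every state.  The transition kernel is Lipschitz in total variation, and
the running cost is a linear combination `θᵀφ` of Lipschitz features. -/
structure ControlModel (nx na nl : ℕ) where
  xmin : Fin nx → ℝ
  xmax : Fin nx → ℝ
  amin : Fin na → ℝ
  amax : Fin na → ℝ
  x_le : xmin ≤ xmax
  a_le : amin ≤ amax
  /-- The transition kernel `Q(· | x, a)`. -/
  Q : Kernel (Set.Icc xmin xmax × Set.Icc amin amax) (Set.Icc xmin xmax)
  markov : IsMarkovKernel Q
  Q_lipschitz : ∃ L : ℝ, 0 ≤ L ∧ ∀ z w, tvDist (Q z) (Q w) ≤ L * pairDist z.1.1 w.1.1 z.2.1 w.2.1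
  /-- The discount factor. -/
  α : ℝ
  α_pos : 0 < α
  α_lt_one : α < 1
  /-- The feature functions. -/
  φ : Fin nl → Set.Icc xmin xmax × Set.Icc amin amax → ℝ
  φ_lipschitz : ∃ L : ℝ, 0 ≤ L ∧ ∀ i z w, |φ i z - φ i w| ≤ L * pairDist z.1.1 w.1.1 z.2.1 w.2.1
  /-- The coefficients of the true running cost. -/
  θ : Fin nl → ℝ

namespace ControlModel

variable {nx na nl : ℕ} (C : ControlModel nx na nl)

/-- The state space. -/
abbrev X : Type := Set.Icc C.xmin C.xmax

/-- The action space. -/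
abbrev A : Type := Set.Icc C.amin C.amax

/-- The set of (feasible) state-action pairs. -/
abbrev K : Type := C.X × C.A

instance : IsMarkovKernel C.Q := C.markov

/-- Lebesgue measure on `X × A`. -/
def lebesgue : Measure C.K :=
  (Measure.comap Subtype.val (volume : Measure (Fin nx → ℝ))).prod
    (Measure.comap Subtype.val (volume : Measure (Fin na → ℝ)))

/-- The true running cost. -/
def cost (z : C.K) : ℝ := ∑ i, C.θ i * C.φ i z

/-- The operator `q*`: `(q*V)(x,a) = ∫ V(χ) Q(dχ | x, a)`. -/
def qStar (V : C.X → ℝ) (z : C.K) : ℝ := ∫ χ, V χ ∂(C.Q z)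

/-- A (randomized, history-dependent) policy: the first action is drawn from a stochastic kernel
given the first state, and every later one from a stochastic kernel given the past state-action
pairs and the present state.  Time is indexed from `0`. -/
structure Policy where
  init : Kernel C.X C.A
  init_markov : IsMarkovKernel init
  step : (n : ℕ) → Kernel (((_i : Finset.Iic n) → C.K) × C.X) C.A
  step_markov : ∀ n, IsMarkovKernel (step n)

namespace Policy

variable {C}
variable (p : C.Policy)

/-- The law of the state-action pair at time `n + 1` given the pairs at the times `0, …, n`. -/
def transition (n : ℕ) : Kernel ((_i : Finset.Iic n) → C.K) C.K :=
  (C.Q.comap (fun h : (_i : Finset.Iic n) → C.K => h ⟨n, Finset.mem_Iic.2 le_rfl⟩)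
    (measurable_pi_apply _)) ⊗ₖ p.step n

instance (n : ℕ) : IsMarkovKernel (p.transition n) := by
  have := p.step_markov n
  unfold transition
  infer_instance

/-- The law of the whole state-action trajectory under the policy, with initial state
distribution `μ₁`. -/
def law (μ₁ : Measure C.X) : Measure (ℕ → C.K) :=
  Kernel.trajMeasure (X := fun _ : ℕ => C.K) (μ₁ ⊗ₘ p.init) p.transition

/-- The expected total discounted cost of the policy. -/
def J (μ₁ : Measure C.X) : ℝ := ∫ η, ∑' t : ℕ, C.α ^ t * C.cost (η t) ∂(p.law μ₁)

/-- `p` minimizes the expected total discounted cost over all policies. -/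
def IsOptimal (μ₁ : Measure C.X) : Prop := ∀ p' : C.Policy, p.J μ₁ ≤ p'.J μ₁

/-- The sum of the state-action occupation measures at the first `N` times. -/
def occupation (μ₁ : Measure C.X) (N : ℕ) : Measure C.K :=
  ∑ t ∈ Finset.range N, (p.law μ₁).map (fun η => η t)

end Policy

/-- The deterministic stationary policy given by a measurable function. -/
def stationary (π : C.X → C.A) (hπ : Measurable π) : C.Policy where
  init := Kernel.deterministic π hπ
  init_markov := inferInstance
  step _ := Kernel.deterministic (fun h => π h.2) (hπ.comp measurable_snd)
  step_markov _ := inferInstance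

/-- The true value function: the optimal expected discounted cost as a function of the initial
state. -/
def value (x : C.X) : ℝ := ⨅ p : C.Policy, p.J (Measure.dirac x)

/-- The function `ψ = ℓ + α q*V - V` for the true running cost and the true value function. -/
def trueψ (z : C.K) : ℝ := C.cost z + C.α * C.qStar C.value z - C.value z.1

/-! ### Polynomials and the finite-dimensional problem -/

/-- Evaluation of a polynomial in the state variables. -/
def evalX (P : MvPolynomial (Fin nx) ℝ) (x : C.X) : ℝ := MvPolynomial.eval x.1 P

/-- Evaluation of a polynomial in the state and action variables. -/
def evalK (P : MvPolynomial (Fin nx ⊕ Fin na) ℝ) (z : C.K) : ℝ :=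
  MvPolynomial.eval (Sum.elim z.1.1 z.2.1) P

/-- The polynomials `(y - ymin) (ymax - y)`, for `y` a state or an action variable, which
describe the box `X × A`. -/
def g : Fin nx ⊕ Fin na → MvPolynomial (Fin nx ⊕ Fin na) ℝ
  | .inl i => (MvPolynomial.X (.inl i) - MvPolynomial.C (C.xmin i)) *
      (MvPolynomial.C (C.xmax i) - MvPolynomial.X (.inl i))
  | .inr i => (MvPolynomial.X (.inr i) - MvPolynomial.C (C.amin i)) *
      (MvPolynomial.C (C.amax i) - MvPolynomial.X (.inr i))

/-- The quadratic module generated by the polynomials `g`. -/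
def quadraticModule : Set (MvPolynomial (Fin nx ⊕ Fin na) ℝ) :=
  {P | ∃ (u₀ : MvPolynomial (Fin nx ⊕ Fin na) ℝ)
      (u : Fin nx ⊕ Fin na → MvPolynomial (Fin nx ⊕ Fin na) ℝ),
      IsSumSq u₀ ∧ (∀ i, IsSumSq (u i)) ∧ P = u₀ + ∑ i, u i * C.g i}

end ControlModel

/-- The dimension of the space of polynomials of degree at most `d` in `n` variables. -/
abbrev polyDim (n d : ℕ) : ℕ := (n + d).choose d

/-- `r` is a basis of the space of polynomials of degree at most `d` in `n` variables. -/
def IsPolyBasis {n d : ℕ} (r : Fin (polyDim n d) → MvPolynomial (Fin n) ℝ) : Prop :=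
  LinearIndependent ℝ r ∧
    Submodule.span ℝ (Set.range r) = MvPolynomial.restrictTotalDegree (Fin n) ℝ d

namespace ControlModel

variable {nx na nl : ℕ} (C : ControlModel nx na nl)

/-- Interpolation nodes in `X × A` for the polynomials of degree at most `d`, together with the
associated Lagrange basis. -/
structure LagrangeSystem (d : ℕ) where
  node : Fin (polyDim (nx + na) d) → C.K
  basis : Fin (polyDim (nx + na) d) → MvPolynomial (Fin nx ⊕ Fin na) ℝ
  degree_le : ∀ k, (basis k).totalDegree ≤ d
  eval_node : ∀ j k, C.evalK (basis k) (node j) = if j = k then 1 else 0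

/-- The polynomial with coordinates `c` in the Lagrange basis. -/
def LagrangeSystem.poly {C : ControlModel nx na nl} {d : ℕ} (L : C.LagrangeSystem d)
    (c : Fin (polyDim (nx + na) d) → ℝ) : MvPolynomial (Fin nx ⊕ Fin na) ℝ :=
  ∑ k, c k • L.basis k

/-- The interpolating polynomial of a function on `X × A`. -/
def LagrangeSystem.interp {C : ControlModel nx na nl} {d : ℕ} (L : C.LagrangeSystem d)
    (f : C.K → ℝ) : MvPolynomial (Fin nx ⊕ Fin na) ℝ :=
  L.poly (fun k => f (L.node k))

/-- `1/M` times the sum of `f` over all state-action pairs of the first `M` trajectories. -/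
def empMean {N : ℕ} (M : ℕ) (s : ℕ → Fin N → C.K) (f : C.K → ℝ) : ℝ :=
  (1 / (M : ℝ)) * ∑ i ∈ Finset.range M, ∑ t, f (s i t)

end ControlModel

/-- The decision variables `(θ_ψ, θ_ℓ, θ_V)` of the finite-dimensional problem. -/
structure Coeffs (Dψ nl DV : ℕ) where
  ψ : Fin Dψ → ℝ
  ell : Fin nl → ℝ
  V : Fin DV → ℝ

namespace ControlModel

variable {nx na nl : ℕ} (C : ControlModel nx na nl)

/-- The feasible set of the finite-dimensional problem, for the Lagrange system `L`, the
coordinates `γ i` of polynomial approximations of the features `φ i`, the polynomials `r`, and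
the bounds `βψ`, `βl`, `βV` on the squared maximum norms of the coefficients. -/
def feasible {d DV : ℕ} (L : C.LagrangeSystem d) (γ : Fin nl → Fin (polyDim (nx + na) d) → ℝ)
    (r : Fin DV → MvPolynomial (Fin nx) ℝ) (βψ βl βV : ℝ) :
    Set (Coeffs (polyDim (nx + na) d) nl DV) :=
  {c | (∀ k, c.ψ k = ∑ i, c.ell i * γ i k +
          ∑ j, c.V j * (C.α * C.qStar (C.evalX (r j)) (L.node k) - C.evalX (r j) (L.node k).1)) ∧
    L.poly c.ψ ∈ C.quadraticModule ∧
    1 ≤ ∑ k, c.ψ k * ∫ z, C.evalK (L.basis k) z ∂C.lebesgue ∧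
    (∀ k, c.ψ k ^ 2 ≤ βψ) ∧ (∀ i, c.ell i ^ 2 ≤ βl) ∧ (∀ j, c.V j ^ 2 ≤ βV)}

/-- The objective `hᵀθ_ψ` of the finite-dimensional problem for `M` observed trajectories. -/
def objective {d DV N : ℕ} (L : C.LagrangeSystem d) (M : ℕ) (s : ℕ → Fin N → C.K)
    (c : Coeffs (polyDim (nx + na) d) nl DV) : ℝ :=
  ∑ k, C.empMean M s (C.evalK (L.basis k)) * c.ψ k

/-- The polynomial estimate `θ_ψᵀφ` of `ψ`. -/
def polyψ {d DV : ℕ} (L : C.LagrangeSystem d) (c : Coeffs (polyDim (nx + na) d) nl DV) :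
    C.K → ℝ :=
  C.evalK (L.poly c.ψ)

/-- The estimate `θ_ℓᵀφ + (α q* - P*)(θ_Vᵀr)` of `ψ`, formed with the exact features and the exact
operator `q*`. -/
def exactψ {Dψ DV : ℕ} (r : Fin DV → MvPolynomial (Fin nx) ℝ) (c : Coeffs Dψ nl DV) (z : C.K) : ℝ :=
  ∑ i, c.ell i * C.φ i z + C.α * C.qStar (fun x => ∑ j, c.V j * C.evalX (r j) x) z -
    ∑ j, c.V j * C.evalX (r j) z.1

/-- The policy reconstruction criterion of a policy `π` for the estimate `ψ` and `M` observed
trajectories. -/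
def policyCriterion {N : ℕ} (M : ℕ) (s : ℕ → Fin N → C.K) (ψ : C.K → ℝ) (π : C.X → C.A) : ℝ :=
  C.empMean M s (fun z => ψ (z.1, π z.1) + sqDist z.2.1 (π z.1).1)

end ControlModel

end

end IOC

/-! The function ψ̄ is the Bellman defect of the value function. The Bellman operator is a
contraction on C(X), because a kernel that is Lipschitz in total variation maps bounded measurable
functions to continuous ones. Telescoping (`hasSum_bellman_defect`) writes the excess cost of a
policy over its fixed point W as the discounted sum of expected defects of W. Hence the value
function is W (`value_eq`), the defect is nonnegative on K (`trueψ_nonneg`), and an optimal policy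
makes it vanish almost surely at every time (`trueψ_ae_eq_zero`). So ψ̄ = 0 at all data points.

Problem (E) has a feasible point of small objective (`exists_feasible`). Approximate the value
function uniformly by a polynomial and subtract a constant, which raises the defect: it then lies
between ψ̄ + e and ψ̄ + 5e. For large d_ψ its interpolated version is a polynomial that is strictly
positive on the box, so Putinar's theorem puts it in the quadratic module. It dominates ψ̄, so the
normalization survives, and it is close to zero on the data.

Every near-minimizer of (E) therefore has small empirical mean on the data, while membership in the
quadratic module keeps it nonnegative on all of K. In (P) the expert parameter thus has a small
criterion, hence so does any near-minimizer. As the ψ-term is almost nonnegative everywhere, the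
empirical squared distance to the expert policy is small (`empMean_sqDist_le`). A law of large
numbers uniform in θ (`uniform_strong_law`) turns this into smallness under the occupation measure.

Putinar's theorem for boxes is proved algebraically. Closing an archimedean quadratic module under
small constants makes it stable under products, since its elements have approximate square roots
(`mul_mem`). The Bernstein weights then belong to it, and a Bernstein expansion with a Lipschitz
error estimate shows that polynomials nonnegative on the cube do too (`aeval_mem_of_nonneg`). -/

namespace IOC

/-! ### Archimedean quadratic modules -/

section QuadraticModule

variable {A : Type*} [CommRing A] [Algebra ℝ A]

/-- A quadratic module in a commutative real algebra. -/
structure IsQuadModule (M : Set A) : Prop where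
  one_mem : (1 : A) ∈ M
  add_mem : ∀ p ∈ M, ∀ q ∈ M, p + q ∈ M
  sq_mul_mem : ∀ s, ∀ p ∈ M, s * s * p ∈ M

/-- `p` lies between `-N` and `N` with respect to the quadratic module `M`. -/
def QBounded (M : Set A) (p : A) (N : ℝ) : Prop :=
  algebraMap ℝ A N - p ∈ M ∧ algebraMap ℝ A N + p ∈ M

namespace IsQuadModule

variable {M : Set A} (hM : IsQuadModule M)
include hM

theorem smul_mem {c : ℝ} (hc : 0 ≤ c) {p : A} (hp : p ∈ M) : algebraMap ℝ A c * p ∈ M := by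
  have := hM.sq_mul_mem (algebraMap ℝ A (Real.sqrt c)) p hp
  rwa [← map_mul, Real.mul_self_sqrt hc] at this

omit [Algebra ℝ A] in
theorem sq_mem (s : A) : s * s ∈ M := by
  simpa using hM.sq_mul_mem s 1 hM.one_mem

theorem const_mem {c : ℝ} (hc : 0 ≤ c) : algebraMap ℝ A c ∈ M := by
  simpa using hM.smul_mem hc hM.one_mem

theorem of_smul_mem {c : ℝ} (hc : 0 < c) {p : A} (hp : algebraMap ℝ A c * p ∈ M) : p ∈ M := by
  have := hM.smul_mem (inv_nonneg.2 hc.le) hp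
  rwa [← mul_assoc, ← map_mul, inv_mul_cancel₀ hc.ne', map_one, one_mul] at this

theorem sum_mem {ι : Type*} (s : Finset ι) (f : ι → A) (h : ∀ i ∈ s, f i ∈ M) :
    ∑ i ∈ s, f i ∈ M := by
  classical
  induction s using Finset.induction_on with
  | empty => simpa using hM.const_mem le_rfl
  | insert a s ha ih =>
    rw [Finset.sum_insert ha]
    exact hM.add_mem _ (h _ (by simp)) _ (ih fun i hi => h i (by simp [hi]))

theorem qbounded_mono {p : A} {N N' : ℝ} (hN : N ≤ N') (h : QBounded M p N) :
    QBounded M p N' := by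
  have hc := hM.const_mem (sub_nonneg.2 hN)
  constructor
  · convert hM.add_mem _ h.1 _ hc using 1; rw [map_sub]; ring
  · convert hM.add_mem _ h.2 _ hc using 1; rw [map_sub]; ring

omit hM in
theorem qbounded_neg {p : A} {N : ℝ} (h : QBounded M p N) : QBounded M (-p) N :=
  ⟨by simpa using h.2, by simpa [sub_eq_add_neg] using h.1⟩

theorem qbounded_add {p q : A} {N K : ℝ} (hp : QBounded M p N) (hq : QBounded M q K) :
    QBounded M (p + q) (N + K) := by
  constructor
  · convert hM.add_mem _ hp.1 _ hq.1 using 1; rw [map_add]; ring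
  · convert hM.add_mem _ hp.2 _ hq.2 using 1; rw [map_add]; ring

theorem qbounded_const (c : ℝ) : QBounded M (algebraMap ℝ A c) |c| := by
  constructor
  · rw [← map_sub]; exact hM.const_mem (sub_nonneg.2 (le_abs_self c))
  · rw [← map_add]; exact hM.const_mem (by linarith [neg_abs_le c])

/-- A quadratic module need not be closed under products, but 2N(N² - p²) = (N + p)²(N - p) + (N -
p)²(N + p) only uses squares as multipliers. -/
theorem sq_sub_mem {p : A} {N : ℝ} (hN : 0 < N) (h : QBounded M p N) :
    algebraMap ℝ A (N * N) - p * p ∈ M := by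
  refine hM.of_smul_mem (c := 2 * N) (by positivity) ?_
  convert hM.add_mem _ (hM.sq_mul_mem (algebraMap ℝ A N + p) _ h.1) _
    (hM.sq_mul_mem (algebraMap ℝ A N - p) _ h.2) using 1
  simp only [map_mul, map_ofNat]; ring

/-- Follows from 2NK(NK + pq) = (Kp + Nq)² + K²(N² - p²) + N²(K² - q²), and the same with -q. -/
theorem qbounded_mul {p q : A} {N K : ℝ} (hN : 0 < N) (hK : 0 < K) (hp : QBounded M p N)
    (hq : QBounded M q K) : QBounded M (p * q) (N * K) := by
  have key : ∀ q : A, QBounded M q K → algebraMap ℝ A (N * K) + p * q ∈ M := by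
    intro q hq
    refine hM.of_smul_mem (c := 2 * (N * K)) (by positivity) ?_
    convert hM.add_mem _ (hM.sq_mem (algebraMap ℝ A K * p + algebraMap ℝ A N * q)) _
      (hM.add_mem _ (hM.smul_mem (mul_self_nonneg K) (hM.sq_sub_mem hN hp)) _
        (hM.smul_mem (mul_self_nonneg N) (hM.sq_sub_mem hK hq))) using 1
    simp only [map_mul, map_ofNat]; ring
  refine ⟨?_, key q hq⟩
  simpa [sub_eq_add_neg] using key (-q) (qbounded_neg hq)

end IsQuadModule

/-- A quadratic module that is archimedean and closed under limits along constants. -/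
structure IsClosedQuadModule (T : Set A) : Prop extends IsQuadModule T where
  arch : ∀ p, ∃ N : ℝ, 0 < N ∧ QBounded T p N
  closed : ∀ p, (∀ ε : ℝ, 0 < ε → p + algebraMap ℝ A ε ∈ T) → p ∈ T

/-- The elements that belong to `M` after adding an arbitrary positive constant. -/
def qClosure (M : Set A) : Set A := {p | ∀ ε : ℝ, 0 < ε → p + algebraMap ℝ A ε ∈ M}

theorem IsQuadModule.subset_qClosure {M : Set A} (hM : IsQuadModule M) : M ⊆ qClosure M :=
  fun _ hp _ hε => hM.add_mem _ hp _ (hM.const_mem hε.le)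

theorem IsQuadModule.isClosedQuadModule_qClosure {M : Set A} (hM : IsQuadModule M)
    (h : ∀ p, ∃ N : ℝ, 0 < N ∧ QBounded M p N) : IsClosedQuadModule (qClosure M) where
  one_mem := hM.subset_qClosure hM.one_mem
  add_mem p hp q hq ε hε := by
    convert hM.add_mem _ (hp (ε / 2) (by positivity)) _ (hq (ε / 2) (by positivity)) using 1
    rw [show p + algebraMap ℝ A (ε / 2) + (q + algebraMap ℝ A (ε / 2)) =
      p + q + (algebraMap ℝ A (ε / 2) + algebraMap ℝ A (ε / 2)) by ring, ← map_add, add_halves]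
  sq_mul_mem s p hp ε hε := by
    -- With s² ≤ N, the identity is s²p + ε = s²(p + ε/N) + (ε/N)(N - s²).
    obtain ⟨N, hN, hs, -⟩ := h (s * s)
    convert hM.add_mem _ (hM.sq_mul_mem s _ (hp (ε / N) (by positivity))) _
      (hM.smul_mem (c := ε / N) (by positivity) hs) using 1
    rw [mul_sub, ← map_mul, div_mul_cancel₀ _ hN.ne']; ring
  arch p := by
    obtain ⟨N, hN, h₁, h₂⟩ := h p
    exact ⟨N, hN, hM.subset_qClosure h₁, hM.subset_qClosure h₂⟩
  closed p hp ε hε := by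
    have := hp (ε / 2) (by positivity) (ε / 2) (by positivity)
    rwa [add_assoc, ← map_add, add_halves] at this

/-! ### Approximate square roots and stability under products. -/

namespace IsClosedQuadModule

/-- Iterates of `y ↦ (t + y²) / 2`, which approximate `1 - √(1 - t)`. -/
noncomputable def sqrtIter (t : A) : ℕ → A
  | 0 => algebraMap ℝ A (1 / 2) * t
  | n + 1 => algebraMap ℝ A (1 / 2) * (t + sqrtIter t n * sqrtIter t n)

theorem sqrtIter_succ (t : A) (n : ℕ) : sqrtIter t (n + 1) =
    algebraMap ℝ A (1 / 2) * (t + sqrtIter t n * sqrtIter t n) := rfl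

theorem sqrtIter_one_bounds (n : ℕ) :
    0 < sqrtIter (1 : ℝ) n ∧ sqrtIter (1 : ℝ) n < 1 := by
  induction n with
  | zero => norm_num [sqrtIter]
  | succ n ih =>
    simp only [sqrtIter, Algebra.algebraMap_self, RingHom.id_apply]
    constructor <;> nlinarith

theorem sqrtIter_one_lt (n : ℕ) : sqrtIter (1 : ℝ) n < sqrtIter (1 : ℝ) (n + 1) := by
  have := sqrtIter_one_bounds n
  simp only [sqrtIter, Algebra.algebraMap_self, RingHom.id_apply]
  nlinarith [mul_pos (sub_pos.2 this.2) (sub_pos.2 this.2)]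

theorem tendsto_sqrtIter_one_sub :
    Tendsto (fun n => sqrtIter (1 : ℝ) (n + 1) - sqrtIter (1 : ℝ) n) atTop (nhds 0) := by
  have hmono : Monotone (sqrtIter (1 : ℝ)) := monotone_nat_of_le_succ fun n => (sqrtIter_one_lt n).le
  have hb : BddAbove (Set.range (sqrtIter (1 : ℝ))) :=
    ⟨1, by rintro _ ⟨n, rfl⟩; exact (sqrtIter_one_bounds n).2.le⟩
  have h := tendsto_atTop_ciSup hmono hb
  simpa using ((tendsto_add_atTop_iff_nat 1).2 h).sub h

variable {T : Set A} (hT : IsClosedQuadModule T)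
include hT

/-- The iterates are polynomials in t with nonnegative coefficients, so |t| ≤ 1 bounds them by their
real values at t = 1. This transfers convergence from the reals to the algebra. -/
theorem qbounded_sqrtIter {t : A} (ht : QBounded T t 1) (n : ℕ) :
    QBounded T (sqrtIter t n) (sqrtIter (1 : ℝ) n) := by
  have hhalf : QBounded T (algebraMap ℝ A (1 / 2)) (1 / 2) := by
    simpa using hT.qbounded_const (1 / 2 : ℝ)
  induction n with
  | zero => exact hT.qbounded_mul (by norm_num) one_pos hhalf ht
  | succ n ih =>
    have hp := (sqrtIter_one_bounds n).1
    exact hT.qbounded_mul (by norm_num) (by positivity) hhalf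
      (hT.qbounded_add ht (hT.qbounded_mul hp hp ih ih))

/-- The same domination applies to increments, since each one is half the previous increment times
the sum of two consecutive iterates. -/
theorem qbounded_sqrtIter_sub {t : A} (ht : QBounded T t 1) (n : ℕ) :
    QBounded T (sqrtIter t (n + 1) - sqrtIter t n)
      (sqrtIter (1 : ℝ) (n + 1) - sqrtIter (1 : ℝ) n) := by
  have hhalf : QBounded T (algebraMap ℝ A (1 / 2)) (1 / 2) := by
    simpa using hT.qbounded_const (1 / 2 : ℝ)
  induction n with
  | zero =>
    have := hT.qbounded_mul (by norm_num) (by norm_num) hhalf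
      (hT.qbounded_mul (by norm_num) (by norm_num) (hT.qbounded_mul (by norm_num) one_pos hhalf ht)
        (hT.qbounded_mul (by norm_num) one_pos hhalf ht))
    convert this using 1
    · simp only [sqrtIter]; ring
    · simp only [sqrtIter, Algebra.algebraMap_self, RingHom.id_apply]; ring
  | succ n ih =>
    have h0 := sqrtIter_one_bounds n
    have h1 := sqrtIter_one_bounds (n + 1)
    have := hT.qbounded_mul (by norm_num)
      (mul_pos (sub_pos.2 (sqrtIter_one_lt n)) (add_pos h1.1 h0.1)) hhalf
      (hT.qbounded_mul (sub_pos.2 (sqrtIter_one_lt n)) (add_pos h1.1 h0.1) ih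
        (hT.qbounded_add (hT.qbounded_sqrtIter ht (n + 1)) (hT.qbounded_sqrtIter ht n)))
    convert this using 1
    · linear_combination sqrtIter_succ t (n + 1) - sqrtIter_succ t n
    · have e1 := sqrtIter_succ (1 : ℝ) (n + 1)
      have e0 := sqrtIter_succ (1 : ℝ) n
      simp only [Algebra.algebraMap_self, RingHom.id_apply] at e0 e1
      linear_combination e1 - e0

/-- Elements of a closed archimedean quadratic module that are bounded by one are
approximately squares. -/
theorem exists_sq_near {f : A} (hf : f ∈ T) (hf1 : 1 - f ∈ T) {ε : ℝ} (hε : 0 < ε) :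
    ∃ s : A, QBounded T (s * s - f) ε := by
  have ht : QBounded T (1 - f) 1 := by
    refine ⟨by simpa using hf, ?_⟩
    rw [map_one]; exact hT.add_mem _ hT.one_mem _ hf1
  obtain ⟨n, hn⟩ := ((tendsto_sqrtIter_one_sub).eventually (gt_mem_nhds (half_pos hε))).exists
  have h := hT.qbounded_sqrtIter_sub ht n
  -- For s = 1 - yₙ and t = 1 - f one has s² - f = t + yₙ² - 2yₙ = 2(yₙ₊₁ - yₙ), which is small
  -- because the increments at t = 1 tend to zero.
  refine ⟨1 - sqrtIter (1 - f) n, ?_⟩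
  have h2 := hT.qbounded_mono (by linarith) (hT.qbounded_add h h) (N' := ε)
  convert h2 using 1
  have hh : algebraMap ℝ A (1 / 2) * 2 = 1 := by
    rw [← map_ofNat (algebraMap ℝ A) 2, ← map_mul]; norm_num
  simp only [sqrtIter]
  linear_combination (-(1 - f + sqrtIter (1 - f) n * sqrtIter (1 - f) n)) * hh

/-- After scaling f below one, replace it by an approximate square s². Then s²h lies in T, and the
error (s² - f)h is at most ε because h is bounded. -/
theorem mul_mem {f h : A} (hf : f ∈ T) (hh : h ∈ T) : f * h ∈ T := by
  obtain ⟨F, hF, hfF, -⟩ := hT.arch f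
  obtain ⟨H, hH, hhH⟩ := hT.arch h
  refine hT.of_smul_mem (c := F⁻¹) (by positivity) (hT.closed _ fun ε hε => ?_)
  have hf1 : 1 - algebraMap ℝ A F⁻¹ * f ∈ T := by
    convert hT.smul_mem (c := F⁻¹) (by positivity) hfF using 1
    rw [mul_sub, ← map_mul, inv_mul_cancel₀ hF.ne', map_one]
  obtain ⟨s, hs⟩ := hT.exists_sq_near (hT.smul_mem (c := F⁻¹) (by positivity) hf) hf1
    (div_pos hε hH)
  have h2 := (hT.qbounded_mul (by positivity) hH hs hhH).1
  rw [div_mul_cancel₀ _ hH.ne'] at h2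
  convert hT.add_mem _ (hT.sq_mul_mem s _ hh) _ h2 using 1
  ring

theorem prod_mem {ι : Type*} (s : Finset ι) (f : ι → A) (h : ∀ i ∈ s, f i ∈ T) :
    ∏ i ∈ s, f i ∈ T := by
  classical
  induction s using Finset.induction_on with
  | empty => simpa using hT.one_mem
  | insert a s ha ih =>
    rw [Finset.prod_insert ha]
    exact hT.mul_mem (h _ (by simp)) (ih fun i hi => h i (by simp [hi]))

theorem pow_mem {f : A} (hf : f ∈ T) (n : ℕ) : f ^ n ∈ T := by
  simpa using hT.prod_mem (Finset.range n) (fun _ => f) fun _ _ => hf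

end IsClosedQuadModule

end QuadraticModule

/-! ### Positive polynomials on boxes -/

namespace IsClosedQuadModule

variable {A : Type*} [CommRing A] [Algebra ℝ A] {T : Set A}
variable {σ : Type*} [Fintype σ]

/-- An upper bound for the distance between `t` and `y`. -/
noncomputable def deviation (t : σ → A) (y : σ → ℝ) (δ : ℝ) : A :=
  ∑ i, (algebraMap ℝ A δ + algebraMap ℝ A δ⁻¹ * (t i - algebraMap ℝ A (y i)) ^ 2)

/-- Completing the square: the element is δ⁻¹(z + δ/2)² + 3δ/4. It serves as a polynomial substitute
for |z| ≤ δ + z²/δ. -/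
theorem deviation_term_mem (hT : IsClosedQuadModule T) (z : A) {δ : ℝ} (hδ : 0 < δ) :
    algebraMap ℝ A δ + algebraMap ℝ A δ⁻¹ * z ^ 2 + z ∈ T := by
  have h1 := hT.smul_mem (inv_nonneg.2 hδ.le)
    (hT.sq_mem (z + algebraMap ℝ A (δ / 2)))
  have h2 := hT.const_mem (c := δ - δ⁻¹ * (δ / 2) * (δ / 2)) (by field_simp; norm_num; exact hδ.le)
  convert hT.add_mem _ h1 _ h2 using 1
  have e : algebraMap ℝ A δ⁻¹ * algebraMap ℝ A (δ / 2) * 2 = 1 := by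
    rw [← map_mul, ← map_ofNat (algebraMap ℝ A) 2, ← map_mul, ← map_one (algebraMap ℝ A)]
    congr 1; field_simp
  rw [map_sub, map_mul, map_mul]
  linear_combination (-z) * e

theorem deviation_add_mem (hT : IsClosedQuadModule T) (t : σ → A) (y : σ → ℝ) {δ : ℝ}
    (hδ : 0 < δ) (i : σ) {c : ℝ} (hc : |c| ≤ 1) :
    deviation t y δ + algebraMap ℝ A c * (t i - algebraMap ℝ A (y i)) ∈ T := by
  classical
  rw [deviation, ← Finset.add_sum_erase _ _ (Finset.mem_univ i), add_right_comm]
  refine hT.add_mem _ ?_ _ (hT.sum_mem _ _ fun j _ => ?_)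
  · have h1 := deviation_term_mem hT (algebraMap ℝ A c * (t i - algebraMap ℝ A (y i))) hδ
    have hc2 : 0 ≤ δ⁻¹ * (1 - c * c) :=
      mul_nonneg (by positivity) (by nlinarith [abs_le.1 hc])
    convert hT.add_mem _ h1 _ (hT.smul_mem hc2 (hT.sq_mem (t i - algebraMap ℝ A (y i)))) using 1
    simp only [map_mul, map_sub, map_one]; ring
  · exact hT.add_mem _ (hT.const_mem hδ.le) _
      (hT.smul_mem (by positivity) (by rw [sq]; exact hT.sq_mem _))

theorem deviation_mem (hT : IsClosedQuadModule T) (t : σ → A) (y : σ → ℝ) {δ : ℝ}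
    (hδ : 0 < δ) : deviation t y δ ∈ T :=
  hT.sum_mem _ _ fun _ _ => hT.add_mem _ (hT.const_mem hδ.le) _
      (hT.smul_mem (by positivity) (by rw [sq]; exact hT.sq_mem _))

/-- A Lipschitz estimate for p in the order defined by T, with a constant uniform in y and δ. The
induction uses p(t)tᵢ - p(y)yᵢ = (p(t) - p(y))tᵢ + p(y)(tᵢ - yᵢ). -/
theorem exists_deviation_bound (hT : IsClosedQuadModule T) (t : σ → A) (ht : ∀ i, t i ∈ T)
    (ht1 : ∀ i, 1 - t i ∈ T) (p : MvPolynomial σ ℝ) :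
    ∃ C : ℝ, 0 ≤ C ∧ ∀ y ∈ Set.Icc (0 : σ → ℝ) 1, ∀ δ : ℝ, 0 < δ →
      algebraMap ℝ A C * deviation t y δ +
        (MvPolynomial.aeval t p - algebraMap ℝ A (MvPolynomial.eval y p)) ∈ T ∧
      algebraMap ℝ A C * deviation t y δ -
        (MvPolynomial.aeval t p - algebraMap ℝ A (MvPolynomial.eval y p)) ∈ T := by
  induction p using MvPolynomial.induction_on with
  | C a =>
    refine ⟨0, le_rfl, fun y _ δ _ => ?_⟩
    have := hT.const_mem (A := A) le_rfl
    constructor <;> simpa using this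
  | add p q hp hq =>
    obtain ⟨C, hC, hp⟩ := hp
    obtain ⟨D, hD, hq⟩ := hq
    refine ⟨C + D, by positivity, fun y hy δ hδ => ?_⟩
    constructor
    · convert hT.add_mem _ (hp y hy δ hδ).1 _ (hq y hy δ hδ).1 using 1
      simp only [map_add]; ring
    · convert hT.add_mem _ (hp y hy δ hδ).2 _ (hq y hy δ hδ).2 using 1
      simp only [map_add]; ring
  | mul_X p i hp =>
    obtain ⟨C, hC, hp⟩ := hp
    obtain ⟨B, hB⟩ := (isCompact_Icc (a := (0 : σ → ℝ)) (b := 1)).exists_bound_of_continuousOn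
      (MvPolynomial.continuous_eval p).continuousOn
    have hB' : 0 < |B| + 1 := by positivity
    refine ⟨C + (|B| + 1), by positivity, fun y hy δ hδ => ?_⟩
    -- Multiplying the induction hypothesis by tᵢ leaves C·dev·tᵢ; adding C·dev·(1 - tᵢ) restores
    -- C·dev.
    have hD := hT.smul_mem hC (hT.mul_mem (deviation_mem hT t y hδ) (ht1 i))
    set c := MvPolynomial.eval y p / (|B| + 1) with hc
    have hc1 : |c| ≤ 1 := by
      rw [hc, abs_div, abs_of_pos hB', div_le_one hB']
      have := hB y hy
      rw [Real.norm_eq_abs] at this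
      linarith [le_abs_self B]
    have hcB : algebraMap ℝ A (|B| + 1) * algebraMap ℝ A c =
        algebraMap ℝ A (MvPolynomial.eval y p) := by
      rw [← map_mul, hc, mul_div_cancel₀ _ hB'.ne']
    constructor
    · convert hT.add_mem _ (hT.add_mem _ (hT.mul_mem (hp y hy δ hδ).1 (ht i)) _ hD) _
        (hT.smul_mem hB'.le (deviation_add_mem hT t y hδ i hc1)) using 1
      simp only [map_mul, MvPolynomial.aeval_X, MvPolynomial.eval_X]
      rw [map_add _ C]
      linear_combination (-(t i - algebraMap ℝ A (y i))) * hcB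
    · convert hT.add_mem _ (hT.add_mem _ (hT.mul_mem (hp y hy δ hδ).2 (ht i)) _ hD) _
        (hT.smul_mem hB'.le (deviation_add_mem hT t y hδ i (c := -c) (by rwa [abs_neg]))) using 1
      simp only [map_mul, MvPolynomial.aeval_X, MvPolynomial.eval_X]
      rw [map_add _ C, map_neg]
      linear_combination (t i - algebraMap ℝ A (y i)) * hcB

/-- The values of the Bernstein polynomials at an element of a real algebra. -/
noncomputable def bern (n : ℕ) (x : A) (j : ℕ) : A := Polynomial.aeval x (bernsteinPolynomial ℝ n j)

theorem bern_mem (hT : IsClosedQuadModule T) {x : A} (hx : x ∈ T) (hx1 : 1 - x ∈ T) (n j : ℕ) :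
    bern n x j ∈ T := by
  have : bern n x j = algebraMap ℝ A (n.choose j) * (x ^ j * (1 - x) ^ (n - j)) := by
    simp [bern, bernsteinPolynomial, mul_assoc]
  rw [this]
  exact hT.smul_mem (by positivity) (hT.mul_mem (hT.pow_mem hx _) (hT.pow_mem hx1 _))

theorem sum_bern (n : ℕ) (x : A) : ∑ j ∈ Finset.range (n + 1), bern n x j = 1 := by
  simpa [bern] using congrArg (Polynomial.aeval x) (bernsteinPolynomial.sum ℝ n)

theorem sum_sq_mul_bern {n : ℕ} (hn : n ≠ 0) (x : A) :
    ∑ j ∈ Finset.range (n + 1), (x - algebraMap ℝ A (j / n)) ^ 2 * bern n x j =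
      algebraMap ℝ A (1 / n) * (x * (1 - x)) := by
  have hn' : (n : ℝ) ≠ 0 := by exact_mod_cast hn
  have h : ∑ j ∈ Finset.range (n + 1), ((n : A) * x - (j : A)) ^ 2 * bern n x j =
      n * x * (1 - x) := by
    simpa [bern] using congrArg (Polynomial.aeval x) (bernsteinPolynomial.variance ℝ n)
  have e1 : algebraMap ℝ A (1 / n) * (n : A) = 1 := by
    rw [← map_natCast (algebraMap ℝ A), ← map_mul, one_div_mul_cancel hn', map_one]
  have e2 (j : ℕ) : algebraMap ℝ A (j / n) = algebraMap ℝ A (1 / n) * (j : A) := by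
    rw [← map_natCast (algebraMap ℝ A), ← map_mul]; congr 1; ring
  calc _ = algebraMap ℝ A (1 / n) ^ 2 *
        ∑ j ∈ Finset.range (n + 1), ((n : A) * x - (j : A)) ^ 2 * bern n x j := by
        rw [Finset.mul_sum]
        refine Finset.sum_congr rfl fun j _ => ?_
        rw [e2]
        have : x - algebraMap ℝ A (1 / n) * (j : A) =
          algebraMap ℝ A (1 / n) * ((n : A) * x - (j : A)) := by linear_combination (-x) * e1
        rw [this]; ring
    _ = _ := by
        rw [h]
        linear_combination (algebraMap ℝ A (1 / n) * (x * (1 - x))) * e1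

/-- A polynomial that is nonnegative on the unit cube is nonnegative with respect to a closed
archimedean quadratic module, when it is evaluated at elements between `0` and `1`. -/
theorem aeval_mem_of_nonneg (hT : IsClosedQuadModule T) (t : σ → A) (ht : ∀ i, t i ∈ T)
    (ht1 : ∀ i, 1 - t i ∈ T) (p : MvPolynomial σ ℝ)
    (hp : ∀ y ∈ Set.Icc (0 : σ → ℝ) 1, 0 ≤ MvPolynomial.eval y p) :
    MvPolynomial.aeval t p ∈ T := by
  classical
  obtain ⟨C, hC, h⟩ := exists_deviation_bound hT t ht ht1 p
  have step (n : ℕ) (hn : n ≠ 0) (δ : ℝ) (hδ : 0 < δ) :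
      MvPolynomial.aeval t p + algebraMap ℝ A (C * (Fintype.card σ * (δ + δ⁻¹ * (1 / n)))) ∈ T := by
    have hn' : (0 : ℝ) < n := by positivity
    set S := Fintype.piFinset fun _ : σ => Finset.range (n + 1)
    set B : (σ → ℕ) → A := fun J => ∏ i, bern n (t i) (J i)
    set y : (σ → ℕ) → σ → ℝ := fun J i => J i / n
    have hB (J : σ → ℕ) : B J ∈ T := hT.prod_mem _ _ fun i _ => bern_mem hT (ht i) (ht1 i) n _
    have hBsum : ∑ J ∈ S, B J = 1 := by
      rw [← Finset.prod_univ_sum]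
      exact Finset.prod_eq_one fun i _ => sum_bern n (t i)
    have hBvar (i : σ) : ∑ J ∈ S, B J * (t i - algebraMap ℝ A (y J i)) ^ 2 =
        algebraMap ℝ A (1 / n) * (t i * (1 - t i)) := by
      -- The squared deviation is inserted only in the i-th factor of the product; the other
      -- one-dimensional sums equal one.
      have e := Finset.prod_univ_sum (fun _ : σ => Finset.range (n + 1)) fun k j =>
        (if k = i then (t i - algebraMap ℝ A (j / n)) ^ 2 else 1) * bern n (t k) j
      rw [← sum_sq_mul_bern hn (t i), ← Finset.mul_prod_erase _ _ (Finset.mem_univ i)] at *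
      rw [Finset.prod_eq_one (s := Finset.univ.erase i), mul_one] at e
      · simp only [if_true] at e
        rw [e]
        refine Finset.sum_congr rfl fun J _ => ?_
        rw [Finset.prod_mul_distrib, Finset.prod_ite_eq' Finset.univ i, if_pos (Finset.mem_univ i),
          mul_comm]
      · intro k hk
        simp only [if_neg (Finset.ne_of_mem_erase hk), one_mul, sum_bern]
    have hy (J) (hJ : J ∈ S) : y J ∈ Set.Icc (0 : σ → ℝ) 1 := by
      refine ⟨fun i => by positivity, fun i => ?_⟩
      have := Finset.mem_range_succ_iff.1 (Fintype.mem_piFinset.1 hJ i)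
      exact (div_le_one hn').2 (by exact_mod_cast this)
    -- The decomposition is p(t) = Σ B_J (p(t) - p(y_J)) + Σ p(y_J) B_J. Here `h1` controls the
    -- first sum at the cost of the averaged deviation, `h2` is the second, and `h3` replaces the
    -- variance tᵢ(1 - tᵢ) in that cost by one.
    have h1 := hT.sum_mem S (fun J => B J * (algebraMap ℝ A C * deviation t (y J) δ +
        (MvPolynomial.aeval t p - algebraMap ℝ A (MvPolynomial.eval (y J) p))))
      fun J hJ => hT.mul_mem (hB J) (h _ (hy J hJ) δ hδ).1
    have h2 := hT.sum_mem S (fun J => algebraMap ℝ A (MvPolynomial.eval (y J) p) * B J)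
      fun J hJ => hT.smul_mem (hp _ (hy J hJ)) (hB J)
    have h3 := hT.sum_mem Finset.univ (fun i : σ => algebraMap ℝ A (C * (δ⁻¹ * (1 / n))) *
        (1 - t i + t i * t i)) fun i _ =>
      hT.smul_mem (by positivity) (hT.add_mem _ (ht1 i) _ (hT.sq_mem _))
    have hdev : ∑ J ∈ S, B J * deviation t (y J) δ =
        ∑ i, (algebraMap ℝ A δ + algebraMap ℝ A δ⁻¹ *
          (algebraMap ℝ A (1 / n) * (t i * (1 - t i)))) := by
      simp only [deviation, Finset.mul_sum]
      rw [Finset.sum_comm]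
      refine Finset.sum_congr rfl fun i _ => ?_
      rw [← hBvar i]
      calc _ = algebraMap ℝ A δ * ∑ J ∈ S, B J +
            algebraMap ℝ A δ⁻¹ * ∑ J ∈ S, B J * (t i - algebraMap ℝ A (y J i)) ^ 2 := by
            rw [Finset.mul_sum, Finset.mul_sum, ← Finset.sum_add_distrib]
            exact Finset.sum_congr rfl fun J _ => by ring
        _ = _ := by rw [hBsum, mul_one]
    convert hT.add_mem _ (hT.add_mem _ h1 _ h2) _ h3 using 1
    calc _ = algebraMap ℝ A C * (∑ i : σ, (algebraMap ℝ A δ + algebraMap ℝ A δ⁻¹ *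
          algebraMap ℝ A (1 / n))) + MvPolynomial.aeval t p * 1 := by
          simp only [Finset.sum_const, Finset.card_univ, nsmul_eq_mul, map_mul, map_add,
            map_natCast]
          ring
      _ = algebraMap ℝ A C * (∑ J ∈ S, B J * deviation t (y J) δ) +
          MvPolynomial.aeval t p * (∑ J ∈ S, B J) +
          ∑ i : σ, algebraMap ℝ A (C * (δ⁻¹ * (1 / n))) * (1 - t i + t i * t i) := by
          rw [hdev, hBsum, add_right_comm, Finset.mul_sum, Finset.mul_sum,
            ← Finset.sum_add_distrib]
          congr 1
          refine Finset.sum_congr rfl fun i _ => ?_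
          simp only [map_mul]; ring
      _ = _ := by
          congr 1
          rw [Finset.mul_sum, Finset.mul_sum, ← Finset.sum_add_distrib, ← Finset.sum_add_distrib]
          refine Finset.sum_congr rfl fun J _ => ?_
          ring
  refine hT.closed _ fun ε hε => ?_
  obtain ⟨k, hk⟩ := exists_nat_gt (2 * (C * Fintype.card σ) / ε)
  have hk0 : (0 : ℝ) < k := lt_of_le_of_lt (by positivity) hk
  have hkn : k ^ 2 ≠ 0 := pow_ne_zero 2 (by exact_mod_cast hk0.ne')
  -- Taking n = k² and δ = 1/k balances the error: δ + 1/(δn) = 2/k.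
  have h1 := step (k ^ 2) hkn (1 / k) (by positivity)
  have e : C * (Fintype.card σ * (1 / k + (1 / k : ℝ)⁻¹ * (1 / ((k ^ 2 : ℕ) : ℝ)))) =
      2 * (C * Fintype.card σ) / k := by
    push_cast; field_simp; ring
  rw [e] at h1
  have h2 : 2 * (C * Fintype.card σ) / k ≤ ε := by
    rw [div_le_iff₀ hk0]; rw [div_lt_iff₀ hε] at hk; linarith
  convert hT.add_mem _ h1 _ (hT.const_mem (sub_nonneg.2 h2)) using 1
  rw [map_sub]; ring

end IsClosedQuadModule

/-- **Putinar's Positivstellensatz** for boxes. -/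
theorem mem_quadModule_of_pos {σ : Type*} [Fintype σ] (lo hi : σ → ℝ) (hlh : ∀ i, lo i < hi i)
    {M : Set (MvPolynomial σ ℝ)} (hM : IsQuadModule M)
    (hg : ∀ i, (MvPolynomial.X i - MvPolynomial.C (lo i)) *
      (MvPolynomial.C (hi i) - MvPolynomial.X i) ∈ M)
    (P : MvPolynomial σ ℝ) {c : ℝ} (hc : 0 < c)
    (hP : ∀ y ∈ Set.Icc lo hi, c ≤ MvPolynomial.eval y P) : P ∈ M := by
  have harch (p : MvPolynomial σ ℝ) : ∃ N : ℝ, 0 < N ∧ QBounded M p N := by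
    induction p using MvPolynomial.induction_on with
    | C a =>
      exact ⟨|a| + 1, by positivity, hM.qbounded_mono (by linarith) (hM.qbounded_const a)⟩
    | add p q hp hq =>
      obtain ⟨N, hN, hp⟩ := hp
      obtain ⟨K, hK, hq⟩ := hq
      exact ⟨N + K, by positivity, hM.qbounded_add hp hq⟩
    | mul_X p i hp =>
      obtain ⟨N, hN, hp⟩ := hp
      set m := (lo i + hi i) / 2
      set ρ := (hi i - lo i) / 2
      -- The generator is ρ² - (X - m)², with m the midpoint and ρ the half-length. Adding (s(X - m)
      -- - 1/2)² with s = ±1 cancels the quadratic term, so each variable is bounded.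
      have e (s : ℝ) (hs : s * s = 1) : MvPolynomial.C (ρ ^ 2 + 1 / 4) -
          MvPolynomial.C s * (MvPolynomial.X i - MvPolynomial.C m) ∈ M := by
        convert hM.add_mem _ (hg i) _ (hM.sq_mem (MvPolynomial.C s *
          (MvPolynomial.X i - MvPolynomial.C m) - MvPolynomial.C (1 / 2))) using 1
        have e1 : (MvPolynomial.C s * MvPolynomial.C s : MvPolynomial σ ℝ) = 1 := by
          rw [← MvPolynomial.C_mul, hs, MvPolynomial.C_1]
        have e2 : (MvPolynomial.C (lo i) + MvPolynomial.C (hi i) : MvPolynomial σ ℝ) =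
            2 * MvPolynomial.C m := by
          rw [← MvPolynomial.C_add, ← map_ofNat (MvPolynomial.C : ℝ →+* MvPolynomial σ ℝ) 2,
            ← MvPolynomial.C_mul]
          congr 1; simp only [m]; ring
        have e3 : (MvPolynomial.C (ρ ^ 2 + 1 / 4) : MvPolynomial σ ℝ) =
            MvPolynomial.C m ^ 2 - MvPolynomial.C (lo i) * MvPolynomial.C (hi i) +
              MvPolynomial.C (1 / 2) * MvPolynomial.C (1 / 2) := by
          simp only [← MvPolynomial.C_mul, ← MvPolynomial.C_add, ← MvPolynomial.C_sub,
            ← MvPolynomial.C_pow]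
          congr 1; simp only [m, ρ]; ring
        have e4 : (MvPolynomial.C (1 / 2) * 2 : MvPolynomial σ ℝ) = 1 := by
          rw [← map_ofNat (MvPolynomial.C : ℝ →+* MvPolynomial σ ℝ) 2, ← MvPolynomial.C_mul]
          norm_num
        rw [e3]
        linear_combination (MvPolynomial.C s * (MvPolynomial.X i - MvPolynomial.C m)) * e4 -
          (MvPolynomial.X i - MvPolynomial.C m) ^ 2 * e1 - MvPolynomial.X i * e2
      have hz : QBounded M (MvPolynomial.X i - MvPolynomial.C m) (ρ ^ 2 + 1 / 4) :=
        ⟨by simpa using e 1 (by norm_num), by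
          have := e (-1) (by norm_num)
          rw [map_neg, map_one, neg_one_mul, sub_neg_eq_add] at this
          exact this⟩
      have hX := hM.qbounded_add hz (hM.qbounded_const m)
      refine ⟨_, ?_, hM.qbounded_mul (K := ρ ^ 2 + 1 / 4 + |m|) hN (by positivity) hp
        (by simpa using hX)⟩
      positivity
  have hT := hM.isClosedQuadModule_qClosure harch
  have hd (i) : 0 < hi i - lo i := sub_pos.2 (hlh i)
  set t : σ → MvPolynomial σ ℝ := fun i =>
    MvPolynomial.C (hi i - lo i)⁻¹ * (MvPolynomial.X i - MvPolynomial.C (lo i)) with ht_def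
  have hCC (i) : (MvPolynomial.C (hi i - lo i) * MvPolynomial.C (hi i - lo i)⁻¹ :
      MvPolynomial σ ℝ) = 1 := by
    rw [← MvPolynomial.C_mul, mul_inv_cancel₀ (hd i).ne', MvPolynomial.C_1]
  have ht (i) : t i ∈ M := by
    refine hM.of_smul_mem (mul_pos (hd i) (hd i)) ?_
    -- (X - lo)² + (X - lo)(hi - X) = (hi - lo)(X - lo), so the rescaled coordinate is in M itself.
    convert hM.add_mem _ (hM.sq_mem (MvPolynomial.X i - MvPolynomial.C (lo i))) _ (hg i) using 1
    simp only [ht_def, MvPolynomial.algebraMap_eq, MvPolynomial.C_mul]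
    have := hCC i
    rw [MvPolynomial.C_sub] at *
    linear_combination ((MvPolynomial.C (hi i) - MvPolynomial.C (lo i)) *
      (MvPolynomial.X i - MvPolynomial.C (lo i))) * this
  have ht1 (i) : 1 - t i ∈ M := by
    refine hM.of_smul_mem (mul_pos (hd i) (hd i)) ?_
    convert hM.add_mem _ (hM.sq_mem (MvPolynomial.C (hi i) - MvPolynomial.X i)) _ (hg i) using 1
    simp only [ht_def, MvPolynomial.algebraMap_eq, MvPolynomial.C_mul]
    have := hCC i
    rw [MvPolynomial.C_sub] at *
    linear_combination (-(MvPolynomial.C (hi i) - MvPolynomial.C (lo i)) *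
      (MvPolynomial.X i - MvPolynomial.C (lo i))) * this
  set l : σ → MvPolynomial σ ℝ := fun i =>
    MvPolynomial.C (lo i) + MvPolynomial.C (hi i - lo i) * MvPolynomial.X i with hl
  -- Applied to P - c, pulled back to the unit cube by `l`. This gives P - c in the closure only,
  -- and the margin c then brings P back into M.
  have hmem := hT.aeval_mem_of_nonneg t (fun i => hM.subset_qClosure (ht i))
    (fun i => hM.subset_qClosure (ht1 i)) (MvPolynomial.aeval l P - MvPolynomial.C c) ?_
  · have e : MvPolynomial.aeval t (MvPolynomial.aeval l P) = P := by
      rw [← AlgHom.comp_apply, MvPolynomial.comp_aeval]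
      convert MvPolynomial.aeval_X_left_apply P using 3
      funext i
      simp only [hl, ht_def, map_add, map_mul, MvPolynomial.aeval_X, MvPolynomial.aeval_C,
        MvPolynomial.algebraMap_eq]
      linear_combination (MvPolynomial.X i - MvPolynomial.C (lo i)) * hCC i
    rw [map_sub, e] at hmem
    simpa using hmem c hc
  · intro y hy
    have e : MvPolynomial.eval y (MvPolynomial.aeval l P) =
        MvPolynomial.eval (fun i => lo i + (hi i - lo i) * y i) P := by
      rw [← MvPolynomial.coe_aeval_eq_eval, ← MvPolynomial.coe_aeval_eq_eval]
      simp only [RingHom.coe_coe]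
      rw [← AlgHom.comp_apply, MvPolynomial.comp_aeval]
      congr 2
      funext i
      simp [hl]
    rw [map_sub, e, MvPolynomial.eval_C, sub_nonneg]
    refine hP _ ⟨fun i => ?_, fun i => ?_⟩
    · have := mul_nonneg (hd i).le (hy.1 i); simpa using this
    · have := mul_le_mul_of_nonneg_left (hy.2 i) (hd i).le
      simp only [Pi.one_apply, mul_one] at this
      change lo i + _ ≤ _
      linarith

/-! ### Dynamic programming -/

theorem continuous_sqDist {n : ℕ} : Continuous fun q : (Fin n → ℝ) × (Fin n → ℝ) =>
    sqDist q.1 q.2 := by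
  unfold sqDist; fun_prop

/-- The selection of near-minimizers of a continuous function in a measurable way. -/
theorem exists_measurable_selector {X A : Type*} [TopologicalSpace X] [SecondCountableTopology X]
    [MeasurableSpace X] [OpensMeasurableSpace X] [Nonempty X] [TopologicalSpace A]
    [MeasurableSpace A] {f : X × A → ℝ} (hf : Continuous f) (h : ∀ x, ∃ a, f (x, a) ≤ 0) {ε : ℝ}
    (hε : 0 < ε) : ∃ π : X → A, Measurable π ∧ ∀ x, f (x, π x) ≤ ε := by
  classical
  choose a ha using h
  have hopen (y : X) : IsOpen {x | f (x, a y) < ε} :=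
    isOpen_lt (hf.comp (by fun_prop)) continuous_const
  -- By the Lindelöf property countably many constant actions suffice; taking the first one that
  -- works at x is measurable.
  obtain ⟨s, hs, hcov⟩ := TopologicalSpace.countable_cover_nhds
    (f := fun y => {x | f (x, a y) < ε})
    fun y => (hopen y).mem_nhds (show f (y, a y) < ε from (ha y).trans_lt hε)
  have hcov' (x : X) : ∃ y ∈ s, f (x, a y) < ε := by
    have : x ∈ ⋃ y ∈ s, {x | f (x, a y) < ε} := hcov ▸ Set.mem_univ x
    simpa using this
  have hne : s.Nonempty := let ⟨y, hy, _⟩ := hcov' (Classical.arbitrary X); ⟨y, hy⟩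
  obtain ⟨u, rfl⟩ := hs.exists_eq_range hne
  have hex (x : X) : ∃ n, f (x, a (u n)) < ε := by
    obtain ⟨_, ⟨n, rfl⟩, hn⟩ := hcov' x; exact ⟨n, hn⟩
  refine ⟨fun x => a (u (Nat.find (hex x))), ?_, fun x => (Nat.find_spec (hex x)).le⟩
  exact (measurable_from_nat (f := fun n => a (u n))).comp
    (measurable_find hex fun n => (hopen _).measurableSet)

theorem hasSum_telescope {α : ℝ} (hα : 0 < α) (hα1 : α < 1) {w : ℕ → ℝ} {B : ℝ}
    (hw : ∀ t, |w t| ≤ B) : HasSum (fun t => α ^ t * (α * w (t + 1) - w t)) (-w 0) := by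
  have hs : Summable fun t => α ^ t * w t := by
    refine Summable.of_norm_bounded (g := fun t => α ^ t * B)
      ((summable_geometric_of_lt_one hα.le hα1).mul_right B) fun t => ?_
    rw [norm_mul, norm_pow, Real.norm_eq_abs, abs_of_pos hα]
    exact mul_le_mul_of_nonneg_left (hw t) (by positivity)
  have h1 := (hasSum_nat_add_iff' 1).2 hs.hasSum
  have e : -w 0 = ∑' t, α ^ t * w t - ∑ i ∈ Finset.range 1, α ^ i * w i - ∑' t, α ^ t * w t := by
    simp
  rw [e]
  exact (h1.sub hs.hasSum).congr_fun fun t => by ring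

namespace ControlModel

variable {nx na nl : ℕ} (C : ControlModel nx na nl)

instance : Nonempty C.X := ⟨⟨C.xmin, Set.left_mem_Icc.2 C.x_le⟩⟩

instance : Nonempty C.A := ⟨⟨C.amin, Set.left_mem_Icc.2 C.a_le⟩⟩

variable {C}

theorem continuous_of_pairDist {f : C.K → ℝ} {L : ℝ}
    (hf : ∀ z w, |f z - f w| ≤ L * pairDist z.1.1 w.1.1 z.2.1 w.2.1) : Continuous f := by
  refine continuous_iff_continuousAt.2 fun w => tendsto_iff_dist_tendsto_zero.2 ?_
  have hc : Continuous fun z : C.K => L * pairDist z.1.1 w.1.1 z.2.1 w.2.1 := by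
    have h1 (i : Fin nx) : Continuous fun z : C.K => z.1.1 i :=
      (continuous_apply i).comp (continuous_subtype_val.comp continuous_fst)
    have h2 (i : Fin na) : Continuous fun z : C.K => z.2.1 i :=
      (continuous_apply i).comp (continuous_subtype_val.comp continuous_snd)
    unfold pairDist sqDist; fun_prop
  refine squeeze_zero (fun _ => dist_nonneg) (fun z => hf z w) ?_
  have := hc.tendsto w
  simpa [pairDist, sqDist] using this

theorem continuous_φ (i : Fin nl) : Continuous (C.φ i) :=
  let ⟨_, _, h⟩ := C.φ_lipschitz
  continuous_of_pairDist (h i)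

theorem continuous_cost : Continuous C.cost :=
  continuous_finsetSum _ fun i _ => continuous_const.mul (continuous_φ i)

/-- V/(|B| + 1) is an admissible test function for the total variation norm, so q*V inherits a
Lipschitz bound from the kernel even when V is merely measurable. -/
theorem continuous_qStar {V : C.X → ℝ} (hV : Measurable V) {B : ℝ} (hB : ∀ x, |V x| ≤ B) :
    Continuous (C.qStar V) := by
  obtain ⟨L, -, hL⟩ := C.Q_lipschitz
  have hB' : 0 < |B| + 1 := by positivity
  refine continuous_of_pairDist (L := (|B| + 1) * L) fun z w => ?_
  have key (z w) : C.qStar V z - C.qStar V w ≤ (|B| + 1) * tvDist (C.Q z) (C.Q w) := by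
    have hbdd : BddAbove (Set.range fun v : {v : C.X → ℝ // Measurable v ∧ ∀ s, |v s| ≤ 1} =>
        ∫ s, v.1 s ∂(C.Q z) - ∫ s, v.1 s ∂(C.Q w)) := by
      refine ⟨2, ?_⟩
      rintro _ ⟨v, rfl⟩
      have h1 (u) : ‖∫ s, v.1 s ∂(C.Q u)‖ ≤ 1 := by
        simpa using norm_integral_le_of_norm_le_const (μ := C.Q u)
          (f := v.1) (C := 1) (Eventually.of_forall fun s => v.2.2 s)
      have := abs_le.1 (h1 z); have := abs_le.1 (h1 w)
      dsimp only; linarith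
    have := le_ciSup hbdd ⟨fun x => (|B| + 1)⁻¹ * V x, by fun_prop, fun x => by
      rw [abs_mul, abs_of_pos (inv_pos.2 hB'), inv_mul_le_iff₀ hB', mul_one]
      linarith [hB x, le_abs_self B]⟩
    simp only [integral_const_mul, ← mul_sub] at this
    rwa [inv_mul_le_iff₀ hB'] at this
  rw [abs_le, mul_assoc]
  have hsymm : pairDist w.1.1 z.1.1 w.2.1 z.2.1 = pairDist z.1.1 w.1.1 z.2.1 w.2.1 := by
    simp only [pairDist, sqDist]
    congr 2 <;> exact Finset.sum_congr rfl fun i _ => by ring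
  have h1 := mul_le_mul_of_nonneg_left (hL z w) hB'.le
  have h2 := mul_le_mul_of_nonneg_left (hL w z) hB'.le
  rw [hsymm] at h2
  constructor <;> linarith [key z w, key w z]

theorem continuous_qStar_continuousMap (V : C(C.X, ℝ)) : Continuous (C.qStar V) :=
  continuous_qStar V.continuous.measurable (B := ‖V‖) fun x => V.norm_coe_le_norm x

theorem integrable_of_continuous {V : C.X → ℝ} (hV : Continuous V) (z : C.K) :
    Integrable V (C.Q z) :=
  (BoundedContinuousFunction.mkOfCompact ⟨V, hV⟩).integrable _

theorem qStar_sub_le (V V' : C(C.X, ℝ)) (z : C.K) : C.qStar V z - C.qStar V' z ≤ dist V V' := by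
  rw [qStar, qStar, ← integral_sub (integrable_of_continuous V.continuous z)
    (integrable_of_continuous V'.continuous z)]
  refine (le_abs_self _).trans ?_
  simpa using norm_integral_le_of_norm_le_const (μ := C.Q z)
    (f := fun x => V x - V' x) (C := dist V V')
    (Eventually.of_forall fun x => by
      rw [← dist_eq_norm]; exact ContinuousMap.dist_apply_le_dist x)

/-- The right-hand side of the Bellman equation before the minimization over actions. -/
noncomputable def bellmanRHS (V : C.X → ℝ) (z : C.K) : ℝ := C.cost z + C.α * C.qStar V z

theorem continuous_bellmanRHS (V : C(C.X, ℝ)) : Continuous (bellmanRHS (C := C) V) :=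
  continuous_cost.add (continuous_const.mul (continuous_qStar_continuousMap V))

/-- The Bellman operator. -/
noncomputable def bellman (V : C(C.X, ℝ)) : C(C.X, ℝ) where
  toFun x := sInf ((fun a => bellmanRHS V (x, a)) '' Set.univ)
  continuous_toFun := isCompact_univ.continuous_sInf (continuous_bellmanRHS V)

theorem bddBelow_bellmanRHS (V : C(C.X, ℝ)) (x : C.X) :
    BddBelow ((fun a => bellmanRHS V (x, a)) '' Set.univ) :=
  (isCompact_univ.image ((continuous_bellmanRHS V).comp (by fun_prop))).bddBelow

theorem exists_bellman_eq (V : C(C.X, ℝ)) (x : C.X) :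
    ∃ a, bellman V x = bellmanRHS V (x, a) := by
  obtain ⟨a, -, ha⟩ := isCompact_univ.exists_sInf_image_eq Set.univ_nonempty
    ((continuous_bellmanRHS V).comp (Continuous.prodMk_right x)).continuousOn
  exact ⟨a, ha⟩

theorem bellman_le (V : C(C.X, ℝ)) (z : C.K) : bellman V z.1 ≤ bellmanRHS V z :=
  csInf_le (bddBelow_bellmanRHS V z.1) ⟨z.2, Set.mem_univ _, rfl⟩

theorem bellman_contracting :
    ContractingWith ⟨C.α, C.α_pos.le⟩ (bellman (C := C)) := by
  refine ⟨by exact_mod_cast C.α_lt_one, LipschitzWith.of_dist_le_mul fun V V' => ?_⟩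
  refine (ContinuousMap.dist_le (mul_nonneg C.α_pos.le dist_nonneg)).2 fun x => ?_
  have key (V V' : C(C.X, ℝ)) : bellman V x - bellman V' x ≤ C.α * dist V V' := by
    obtain ⟨a, ha⟩ := exists_bellman_eq V' x
    have h1 := bellman_le V (x, a)
    have h2 := mul_le_mul_of_nonneg_left (qStar_sub_le V V' (x, a)) C.α_pos.le
    rw [ha]
    simp only [bellmanRHS] at *
    linarith
  rw [Real.dist_eq, abs_le]
  have h1 := key V V'
  have h2 := key V' V
  rw [dist_comm] at h2
  constructor
  · change -(C.α * _) ≤ _; linarith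
  · exact h1

theorem exists_bellman_fixedPoint (C : ControlModel nx na nl) : ∃ W : C(C.X, ℝ),
    (∀ z : C.K, W z.1 ≤ bellmanRHS W z) ∧ ∀ x, ∃ a, W x = bellmanRHS W (x, a) := by
  have h := (bellman_contracting (C := C)).fixedPoint_isFixedPt
  set W := ContractingWith.fixedPoint (bellman (C := C)) bellman_contracting
  refine ⟨W, fun z => ?_, fun x => ?_⟩
  · have := bellman_le W z
    rwa [h] at this
  · have := exists_bellman_eq W x
    rwa [h] at this

instance (p : C.Policy) : IsMarkovKernel p.init := p.init_markov

instance (p : C.Policy) (n : ℕ) : IsMarkovKernel (p.step n) := p.step_markov n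

instance (p : C.Policy) (μ : Measure C.X) [IsProbabilityMeasure μ] :
    IsProbabilityMeasure (p.law μ) := by
  unfold Policy.law; infer_instance

/-! ### Trajectory laws and discounted sums. -/

namespace Policy

variable (p : C.Policy) (μ : Measure C.X)

theorem map_law_zero : (p.law μ).map (fun η => η 0) = μ ⊗ₘ p.init := by
  have h : (fun η : ℕ → C.K => η 0) =
      (MeasurableEquiv.piUnique fun _ : Finset.Iic 0 => C.K) ∘ (Preorder.frestrictLe 0) := rfl
  rw [h, ← Measure.map_map (MeasurableEquiv.measurable _) (by fun_prop), law, Kernel.trajMeasure,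
    Measure.map_comp _ _ (by fun_prop), Kernel.traj_map_frestrictLe, Kernel.partialTraj_self,
    Measure.id_comp, Measure.map_map (MeasurableEquiv.measurable _) (MeasurableEquiv.measurable _),
    MeasurableEquiv.self_comp_symm, Measure.map_id]

variable [IsProbabilityMeasure μ]

theorem ae_law_succ (n : ℕ) {P : C.K → Prop} (hP : MeasurableSet {z | P z})
    (h : ∀ u, ∀ᵐ z ∂(p.transition n u), P z) : ∀ᵐ η ∂(p.law μ), P (η (n + 1)) := by
  have e := Kernel.map_frestrictLe_trajMeasure_compProd_eq_map_trajMeasure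
    (X := fun _ => C.K) (μ₀ := μ ⊗ₘ p.init) (κ := p.transition) (a := n)
  have h1 : ∀ᵐ q ∂((p.law μ).map (fun η => (Preorder.frestrictLe n η, η (n + 1)))), P q.2 := by
    rw [law, ← e]
    refine Measure.ae_compProd_of_ae_ae (measurable_snd hP) (Eventually.of_forall fun u => h u)
  exact ae_of_ae_map (p := fun q : (Finset.Iic n → C.K) × C.K => P q.2)
    (μ := p.law μ) (f := fun η => (Preorder.frestrictLe n η, η (n + 1))) (by fun_prop) h1

theorem integral_law_zero {V : C.X → ℝ} (hV : Continuous V) :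
    ∫ η, V (η 0).1 ∂(p.law μ) = ∫ x, V x ∂μ := by
  have h := integral_map (μ := p.law μ) (φ := fun η => η 0) (measurable_pi_apply 0).aemeasurable
    (f := fun z : C.K => V z.1) (by exact (hV.comp continuous_fst).aestronglyMeasurable)
  rw [← h, map_law_zero]
  have h2 := integral_map (μ := μ ⊗ₘ p.init) (φ := Prod.fst) (by fun_prop)
    (f := V) hV.aestronglyMeasurable
  rw [← h2]
  change ∫ y, V y ∂((μ ⊗ₘ p.init).fst) = _
  rw [Measure.fst_compProd]

theorem integral_law_succ {V : C.X → ℝ} (hV : Continuous V) (n : ℕ) :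
    ∫ η, V (η (n + 1)).1 ∂(p.law μ) = ∫ η, C.qStar V (η n) ∂(p.law μ) := by
  have e := Kernel.map_frestrictLe_trajMeasure_compProd_eq_map_trajMeasure
    (X := fun _ => C.K) (μ₀ := μ ⊗ₘ p.init) (κ := p.transition) (a := n)
  change (p.law μ).map _ ⊗ₘ _ = (p.law μ).map _ at e
  have hVK : Continuous fun z : C.K => V z.1 := hV.comp continuous_fst
  have h := integral_map (μ := p.law μ)
    (φ := fun η => (Preorder.frestrictLe (π := fun _ => C.K) n η, η (n + 1))) (by fun_prop)
    (f := fun q => V q.2.1) (by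
      exact (hV.measurable.comp (measurable_fst.comp measurable_snd)).aestronglyMeasurable)
  obtain ⟨B, hB⟩ : ∃ B, ∀ x, |V x| ≤ B :=
    ⟨‖(⟨V, hV⟩ : C(C.X, ℝ))‖, fun x => (⟨V, hV⟩ : C(C.X, ℝ)).norm_coe_le_norm x⟩
  have hprob : IsProbabilityMeasure ((p.law μ).map (Preorder.frestrictLe (π := fun _ => C.K) n)) :=
    Measure.isProbabilityMeasure_map (by fun_prop)
  rw [← h, ← e, Measure.integral_compProd, integral_map (by fun_prop)]
  · refine integral_congr_ae (Eventually.of_forall fun η => ?_)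
    have h2 := integral_map (μ := p.transition n (Preorder.frestrictLe n η)) (φ := Prod.fst)
      (by fun_prop) (f := V) hV.aestronglyMeasurable
    dsimp only
    rw [← h2, ← Kernel.map_apply _ measurable_fst]
    rw [show (p.transition n).map Prod.fst = (p.transition n).fst from
      (Kernel.fst_eq _).symm, transition, Kernel.fst_compProd]
    rfl
  · exact (StronglyMeasurable.integral_kernel
      (hVK.measurable.stronglyMeasurable)).aestronglyMeasurable
  · refine Integrable.of_bound (C := B)
      (hV.measurable.comp (measurable_fst.comp measurable_snd)).aestronglyMeasurable
      (Eventually.of_forall fun q => hB _)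

theorem integrable_law {f : C.K → ℝ} (hf : Continuous f) (n : ℕ) :
    Integrable (fun η => f (η n)) (p.law μ) := by
  have : IsProbabilityMeasure ((p.law μ).map (fun η => η n)) :=
    Measure.isProbabilityMeasure_map (measurable_pi_apply n).aemeasurable
  have h : Integrable f ((p.law μ).map (fun η => η n)) :=
    (BoundedContinuousFunction.mkOfCompact ⟨f, hf⟩).integrable _
  exact h.comp_measurable (measurable_pi_apply n)

theorem hasSum_integral {f : C.K → ℝ} (hf : Continuous f) :
    HasSum (fun t => C.α ^ t * ∫ η, f (η t) ∂(p.law μ))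
      (∫ η, ∑' t : ℕ, C.α ^ t * f (η t) ∂(p.law μ)) := by
  obtain ⟨B, hB⟩ : ∃ B, ∀ x, |f x| ≤ B :=
    ⟨‖(⟨f, hf⟩ : C(C.K, ℝ))‖, fun x => (⟨f, hf⟩ : C(C.K, ℝ)).norm_coe_le_norm x⟩
  have h := hasSum_integral_of_summable_integral_norm (μ := p.law μ)
    (F := fun t η => C.α ^ t * f (η t)) (fun t => (p.integrable_law μ hf t).const_mul _) ?_
  · simpa only [integral_const_mul] using h
  · refine Summable.of_nonneg_of_le (fun t => integral_nonneg fun _ => norm_nonneg _) (fun t => ?_)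
      ((summable_geometric_of_lt_one C.α_pos.le C.α_lt_one).mul_right B)
    have := norm_integral_le_of_norm_le_const (μ := p.law μ)
      (f := fun η => ‖C.α ^ t * f (η t)‖) (C := C.α ^ t * B) (Eventually.of_forall fun η => by
        rw [norm_norm, norm_mul, norm_pow, Real.norm_eq_abs, abs_of_pos C.α_pos]
        exact mul_le_mul_of_nonneg_left (hB _) (pow_nonneg C.α_pos.le _))
    simpa using (le_abs_self _).trans this

/-- The difference between the cost of a policy and the integral of a function `W` is the
discounted sum of the Bellman defects of `W`. -/
theorem hasSum_bellman_defect (W : C(C.X, ℝ)) :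
    HasSum (fun t => C.α ^ t * ∫ η, (bellmanRHS W (η t) - W (η t).1) ∂(p.law μ))
      (p.J μ - ∫ x, W x ∂μ) := by
  have h1 := p.hasSum_integral μ continuous_cost
  -- The expectation of W at time t + 1 equals that of q*W at time t, so the W-terms telescope to
  -- minus the initial integral.
  have h2 := hasSum_telescope C.α_pos C.α_lt_one (w := fun t => ∫ η, W (η t).1 ∂(p.law μ))
    (B := ‖W‖) fun t => by
      simpa using norm_integral_le_of_norm_le_const (μ := p.law μ) (f := fun η => W (η t).1)
        (Eventually.of_forall fun η => W.norm_coe_le_norm _)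
  have h3 := h1.add h2
  rw [p.integral_law_zero μ W.continuous, ← sub_eq_add_neg] at h3
  refine h3.congr_fun fun t => ?_
  have hW : Continuous fun z : C.K => W z.1 := W.continuous.comp continuous_fst
  have hq := continuous_qStar_continuousMap W
  rw [p.integral_law_succ μ W.continuous]
  simp only [bellmanRHS]
  rw [integral_sub, integral_add, integral_const_mul]
  · ring
  · exact p.integrable_law μ continuous_cost t
  · exact (p.integrable_law μ hq t).const_mul _
  · exact (p.integrable_law μ continuous_cost t).add ((p.integrable_law μ hq t).const_mul _)
  · exact p.integrable_law μ hW t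

end Policy

theorem stationary_ae (π : C.X → C.A) (hπ : Measurable π) (μ : Measure C.X)
    [IsProbabilityMeasure μ] (t : ℕ) :
    ∀ᵐ η ∂((C.stationary π hπ).law μ), (η t).2 = π (η t).1 := by
  have hS : MeasurableSet {z : C.K | z.2 = π z.1} :=
    measurableSet_eq_fun measurable_snd (hπ.comp measurable_fst)
  cases t with
  | zero =>
    have h : ∀ᵐ z ∂(((C.stationary π hπ).law μ).map (fun η => η 0)), z.2 = π z.1 := by
      rw [Policy.map_law_zero]
      refine Measure.ae_compProd_of_ae_ae hS (Eventually.of_forall fun x => ?_)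
      simp [stationary, Kernel.deterministic_apply, ae_dirac_eq]
    exact ae_of_ae_map (measurable_pi_apply 0).aemeasurable h
  | succ n =>
    refine Policy.ae_law_succ _ μ n hS fun u => ?_
    rw [Policy.transition]
    refine Kernel.ae_compProd_of_ae_ae hS (Eventually.of_forall fun x => ?_)
    simp [stationary, Kernel.deterministic_apply, ae_dirac_eq]

/-! ### The Bellman fixed point is the value function. -/

section Optimality

variable {W : C(C.X, ℝ)} (h1 : ∀ z : C.K, W z.1 ≤ bellmanRHS W z)
include h1

theorem integral_le_J (p : C.Policy) (μ : Measure C.X) [IsProbabilityMeasure μ] :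
    ∫ x, W x ∂μ ≤ p.J μ :=
  sub_nonneg.1 ((p.hasSum_bellman_defect μ W).nonneg fun _ =>
    mul_nonneg (pow_nonneg C.α_pos.le _) (integral_nonneg fun _ => sub_nonneg.2 (h1 _)))

variable (h2 : ∀ x, ∃ a, W x = bellmanRHS W (x, a))
include h2

omit h1 in
theorem exists_policy_J_le {ε : ℝ} (hε : 0 < ε) : ∃ p : C.Policy,
    ∀ (μ : Measure C.X) [IsProbabilityMeasure μ], p.J μ ≤ ∫ x, W x ∂μ + ε := by
  have hα : 0 < 1 - C.α := sub_pos.2 C.α_lt_one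
  have hc : Continuous fun z : C.K => bellmanRHS W z - W z.1 :=
    (continuous_bellmanRHS W).sub (W.continuous.comp continuous_fst)
  -- Defect at most ε(1 - α) in each step sums geometrically to ε.
  obtain ⟨π, hπ, hle⟩ := exists_measurable_selector hc
    (fun x => let ⟨a, ha⟩ := h2 x; ⟨a, by simp [← ha]⟩) (mul_pos hε hα)
  refine ⟨C.stationary π hπ, fun μ _ => ?_⟩
  have hs := (C.stationary π hπ).hasSum_bellman_defect μ W
  have hg := (hasSum_geometric_of_lt_one C.α_pos.le C.α_lt_one).mul_right (ε * (1 - C.α))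
  have := hasSum_le (fun t => ?_) hs hg
  · rw [mul_comm ε, inv_mul_cancel_left₀ hα.ne'] at this
    linarith
  · refine mul_le_mul_of_nonneg_left ?_ (pow_nonneg C.α_pos.le _)
    calc _ ≤ ∫ η, ε * (1 - C.α) ∂((C.stationary π hπ).law μ) := by
          refine integral_mono_ae (Policy.integrable_law _ μ hc t) (integrable_const _) ?_
          filter_upwards [stationary_ae π hπ μ t] with η hη
          have := hle (η t).1
          rwa [← hη] at this
      _ = _ := by simp

theorem value_eq : C.value = W := by
  funext x
  have hW : ∫ y, W y ∂(Measure.dirac x) = W x := integral_dirac _ _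
  have : Nonempty C.Policy := ⟨(exists_policy_J_le h2 one_pos).choose⟩
  have hb (p : C.Policy) : W x ≤ p.J (Measure.dirac x) := hW ▸ integral_le_J h1 p _
  refine le_antisymm (le_of_forall_pos_le_add fun ε hε => ?_) (le_ciInf hb)
  obtain ⟨p, hp⟩ := exists_policy_J_le h2 hε
  have := hp (Measure.dirac x)
  rw [hW] at this
  exact (ciInf_le ⟨W x, by rintro _ ⟨q, rfl⟩; exact hb q⟩ p).trans this

end Optimality

theorem continuous_value : Continuous C.value := by
  obtain ⟨W, h1, h2⟩ := C.exists_bellman_fixedPoint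
  rw [value_eq h1 h2]; exact W.continuous

theorem continuous_trueψ : Continuous C.trueψ :=
  (continuous_cost.add (continuous_const.mul
    (continuous_qStar_continuousMap ⟨C.value, continuous_value⟩))).sub
      (continuous_value.comp continuous_fst)

theorem trueψ_nonneg (z : C.K) : 0 ≤ C.trueψ z := by
  obtain ⟨W, h1, h2⟩ := C.exists_bellman_fixedPoint
  rw [trueψ, value_eq h1 h2]; exact sub_nonneg.2 (h1 z)

theorem trueψ_ae_eq_zero {p : C.Policy} {μ : Measure C.X} [IsProbabilityMeasure μ]
    (hp : p.IsOptimal μ) (t : ℕ) : ∀ᵐ η ∂(p.law μ), C.trueψ (η t) = 0 := by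
  obtain ⟨W, h1, h2⟩ := C.exists_bellman_fixedPoint
  have hψ (z : C.K) : C.trueψ z = bellmanRHS W z - W z.1 := by
    rw [trueψ, value_eq h1 h2]; rfl
  have hs := p.hasSum_bellman_defect μ W
  -- The ε-optimal policies work for every initial law, so an optimal policy attains ∫ W dμ. A
  -- vanishing sum of nonnegative defects then forces every term to vanish.
  have hz : p.J μ - ∫ x, W x ∂μ = 0 := by
    refine le_antisymm (le_of_forall_pos_le_add fun ε hε => ?_)
      (sub_nonneg.2 (integral_le_J h1 p μ))
    obtain ⟨q, hq⟩ := exists_policy_J_le h2 hε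
    linarith [hq μ, hp q]
  rw [hz] at hs
  have hnn (s : ℕ) : 0 ≤ C.α ^ s * ∫ η, (bellmanRHS W (η s) - W (η s).1) ∂(p.law μ) :=
    mul_nonneg (pow_nonneg C.α_pos.le s) (integral_nonneg fun η => sub_nonneg.2 (h1 (η s)))
  have h0 : C.α ^ t * ∫ η, (bellmanRHS W (η t) - W (η t).1) ∂(p.law μ) = 0 :=
    congrFun ((hasSum_zero_iff_of_nonneg hnn).1 hs) t
  have h0t : ∫ η, C.trueψ (η t) ∂(p.law μ) = 0 := by
    simp only [hψ]
    exact (mul_eq_zero.1 h0).resolve_left (pow_ne_zero t C.α_pos.ne')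
  have hn : 0 ≤ fun η : ℕ → C.K => C.trueψ (η t) := fun η => trueψ_nonneg (η t)
  have hi := p.integrable_law μ (continuous_trueψ (C := C)) t
  filter_upwards [(integral_eq_zero_iff_of_nonneg hn hi).1 h0t] with η hη
  exact hη

end ControlModel

/-! ### Polynomial approximation and interpolation -/

/-- Stars and bars: an extra slack variable turns monomials of degree at most d into monomials of
degree exactly d. -/
theorem finrank_restrictTotalDegree_le (σ : Type*) [Fintype σ] (d : ℕ) :
    Module.finrank ℝ (MvPolynomial.restrictTotalDegree σ ℝ d) ≤ (Fintype.card σ + d).choose d := by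
  classical
  set S : Set (σ →₀ ℕ) := {n | (n.sum fun _ e => e) ≤ d}
  have hfin : Module.finrank ℝ (MvPolynomial.restrictTotalDegree σ ℝ d) = Nat.card S :=
    Module.finrank_eq_nat_card_basis (MvPolynomial.basisRestrictSupport ℝ S)
  rw [hfin]
  have hsum (n : σ →₀ ℕ) : (n.sum fun _ e => e) = ∑ i, n i :=
    Finsupp.sum_fintype _ _ fun _ => rfl
  let f (n : S) : Option σ →₀ ℕ :=
    Finsupp.equivFunOnFinite.symm fun o => o.elim (d - ∑ i, n.1 i) n.1
  have hf (n : S) : f n ∈ Finset.finsuppAntidiag (Finset.univ : Finset (Option σ)) d := by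
    have : ∑ i, n.1 i ≤ d := hsum n.1 ▸ n.2
    simp only [Finset.mem_finsuppAntidiag, Finset.subset_univ, and_true, f]
    simp [Fintype.sum_option, this]
  have hinj : Function.Injective fun n : S =>
      (⟨f n, hf n⟩ : {g // g ∈ Finset.finsuppAntidiag (Finset.univ : Finset (Option σ)) d}) := by
    intro m n hmn
    ext i
    have := DFunLike.congr_fun (congrArg Subtype.val hmn) (some i)
    simpa [f] using this
  have h := Nat.card_le_card_of_injective _ hinj
  rw [Nat.card_eq_finsetCard, Finset.card_finsuppAntidiag_nat_eq_choose,
    Finset.card_univ, Fintype.card_option] at h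
  rwa [add_right_comm, Nat.add_sub_cancel] at h

namespace ControlModel

variable {nx na nl : ℕ} {C : ControlModel nx na nl}

theorem evalK_continuous (P : MvPolynomial (Fin nx ⊕ Fin na) ℝ) : Continuous (C.evalK P) := by
  refine (MvPolynomial.continuous_eval P).comp (continuous_pi fun i => ?_)
  cases i with
  | inl i => exact (continuous_apply i).comp (continuous_subtype_val.comp continuous_fst)
  | inr i => exact (continuous_apply i).comp (continuous_subtype_val.comp continuous_snd)

theorem evalX_continuous (P : MvPolynomial (Fin nx) ℝ) : Continuous (C.evalX P) :=
  (MvPolynomial.continuous_eval P).comp continuous_subtype_val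

theorem evalK_rename (P : MvPolynomial (Fin nx) ℝ) (z : C.K) :
    C.evalK (MvPolynomial.rename Sum.inl P) z = C.evalX P z.1 := by
  simp [evalK, evalX, MvPolynomial.eval_rename]

namespace LagrangeSystem

variable {d : ℕ} (L : C.LagrangeSystem d)

theorem evalK_poly (c : Fin (polyDim (nx + na) d) → ℝ) (z : C.K) :
    C.evalK (L.poly c) z = ∑ k, c k * C.evalK (L.basis k) z := by
  simp [evalK, poly, MvPolynomial.smul_eval]

theorem evalK_poly_node (c : Fin (polyDim (nx + na) d) → ℝ) (j) :
    C.evalK (L.poly c) (L.node j) = c j := by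
  simp [evalK_poly, L.eval_node]

/-- The Lagrange polynomials are independent by evaluation at the nodes, and there are at least as
many as the dimension, so they span and interpolation is exact. -/
theorem poly_eval_node {R : MvPolynomial (Fin nx ⊕ Fin na) ℝ} (hR : R.totalDegree ≤ d) :
    L.poly (fun k => C.evalK R (L.node k)) = R := by
  have hli : LinearIndependent ℝ L.basis := by
    rw [Fintype.linearIndependent_iff]
    intro c hc j
    rw [← L.evalK_poly_node c j, poly, hc]
    simp [evalK]
  have hle : Submodule.span ℝ (Set.range L.basis) ≤
      MvPolynomial.restrictTotalDegree (Fin nx ⊕ Fin na) ℝ d := by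
    rw [Submodule.span_le]
    rintro _ ⟨k, rfl⟩
    exact (MvPolynomial.mem_restrictTotalDegree _ _ _).2 (L.degree_le k)
  have heq := Submodule.eq_of_le_of_finrank_le hle (by
    rw [finrank_span_eq_card hli, Fintype.card_fin]
    simpa using finrank_restrictTotalDegree_le (Fin nx ⊕ Fin na) d)
  have hmem : R ∈ Submodule.span ℝ (Set.range L.basis) :=
    heq ▸ (MvPolynomial.mem_restrictTotalDegree _ _ _).2 hR
  obtain ⟨c, rfl⟩ := (Submodule.mem_span_range_iff_exists_fun ℝ).1 hmem
  change L.poly (fun k => C.evalK (L.poly c) (L.node k)) = L.poly c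
  simp only [evalK_poly_node]

theorem evalK_interp_fst {R : MvPolynomial (Fin nx) ℝ} (hR : R.totalDegree ≤ d) (z : C.K) :
    C.evalK (L.interp fun w => C.evalX R w.1) z = C.evalX R z.1 := by
  have := L.poly_eval_node ((MvPolynomial.totalDegree_rename_le Sum.inl R).trans hR)
  simp only [evalK_rename] at this
  rw [interp, this, evalK_rename]

end LagrangeSystem

theorem exists_polynomial_near (V : C(C.X, ℝ)) {ε : ℝ} (hε : 0 < ε) :
    ∃ P : MvPolynomial (Fin nx) ℝ, ∀ x, |C.evalX P x - V x| < ε := by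
  let coord (i : Fin nx) : C(C.X, ℝ) := ⟨fun x => x.1 i, (continuous_apply i).comp continuous_subtype_val⟩
  have hcoord (P : MvPolynomial (Fin nx) ℝ) (x : C.X) :
      MvPolynomial.aeval coord P x = C.evalX P x := by
    induction P using MvPolynomial.induction_on with
    | C a => simp [evalX]
    | add p q hp hq => simp only [map_add, ContinuousMap.add_apply, hp, hq, evalX]
    | mul_X p i hp => simp only [map_mul, ContinuousMap.mul_apply, hp, evalX,
        MvPolynomial.aeval_X, MvPolynomial.eval_X]; rfl
  obtain ⟨⟨_, P, rfl⟩, hP⟩ :=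
    ContinuousMap.exists_mem_subalgebra_near_continuousMap_of_separatesPoints
      (MvPolynomial.aeval (R := ℝ) coord).range (fun x y hxy => by
        obtain ⟨i, hi⟩ := Function.ne_iff.1 (Subtype.coe_injective.ne hxy)
        exact ⟨_, ⟨coord i, ⟨MvPolynomial.X i, MvPolynomial.aeval_X _ _⟩, rfl⟩, hi⟩) V ε hε
  refine ⟨P, fun x => ?_⟩
  have := (ContinuousMap.norm_lt_iff _ hε).1 hP x
  rw [← hcoord]
  exact this

theorem exists_coeff_eval {n d : ℕ} {r : Fin (polyDim n d) → MvPolynomial (Fin n) ℝ}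
    (hr : IsPolyBasis r) {P : MvPolynomial (Fin n) ℝ} (hP : P.totalDegree ≤ d) :
    ∃ v : Fin (polyDim n d) → ℝ, ∑ j, v j • r j = P :=
  (Submodule.mem_span_range_iff_exists_fun ℝ).1
    (hr.2 ▸ (MvPolynomial.mem_restrictTotalDegree _ _ _).2 hP)

theorem evalX_sum {n : ℕ} (v : Fin n → ℝ) (r : Fin n → MvPolynomial (Fin nx) ℝ) (x : C.X) :
    C.evalX (∑ j, v j • r j) x = ∑ j, v j * C.evalX (r j) x := by
  simp [evalX, MvPolynomial.smul_eval]

/-- Near-best uniform approximations of a continuous function in bases of polynomials of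
increasing degree. -/
theorem exists_approximation (V : C(C.X, ℝ))
    {r : (dV : ℕ) → Fin (polyDim nx (2 * dV)) → MvPolynomial (Fin nx) ℝ}
    (hr : ∀ dV, IsPolyBasis (r dV)) :
    ∃ (v : (dV : ℕ) → Fin (polyDim nx (2 * dV)) → ℝ) (e : ℕ → ℝ), (∀ dV, 0 < e dV) ∧
      Tendsto e atTop (nhds 0) ∧
      ∀ dV x, |∑ j, v dV j * C.evalX (r dV j) x - V x| ≤ e dV := by
  let f (dV : ℕ) (v : Fin (polyDim nx (2 * dV)) → ℝ) : ℝ :=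
    ‖(⟨fun x => ∑ j, v j * C.evalX (r dV j) x - V x, by
      have := fun j => evalX_continuous (C := C) (r dV j); fun_prop⟩ : C(C.X, ℝ))‖
  have hb (dV) : BddBelow (Set.range (f dV)) := ⟨0, by rintro _ ⟨v, rfl⟩; exact norm_nonneg _⟩
  have h0 (dV) : 0 ≤ ⨅ v, f dV v := le_ciInf fun v => norm_nonneg _
  have hlt (dV : ℕ) : ⨅ v, f dV v < (⨅ v, f dV v) + 1 / ((dV : ℝ) + 1) := by
    have : (0 : ℝ) < 1 / ((dV : ℝ) + 1) := by positivity
    linarith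
  choose v hv using fun dV => exists_lt_of_ciInf_lt (hlt dV)
  refine ⟨v, fun dV => (⨅ v, f dV v) + 1 / ((dV : ℝ) + 1), fun dV => ?_, ?_, fun dV x => ?_⟩
  · exact (h0 dV).trans_lt (hlt dV)
  · have hinf : Tendsto (fun dV => ⨅ v, f dV v) atTop (nhds 0) := by
      refine tendsto_order.2 ⟨fun a ha => Eventually.of_forall fun dV => ha.trans_le (h0 dV),
        fun ε hε => ?_⟩
      obtain ⟨P, hP⟩ := exists_polynomial_near V hε
      filter_upwards [eventually_ge_atTop P.totalDegree] with dV hdV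
      obtain ⟨w, hw⟩ := exists_coeff_eval (hr dV) (P := P) (by omega)
      refine (ciInf_le (hb dV) w).trans_lt ((ContinuousMap.norm_lt_iff _ hε).2 fun x => ?_)
      have := hP x
      rw [← hw, evalX_sum] at this
      exact this
    simpa using hinf.add tendsto_one_div_add_atTop_nhds_zero_nat
  · exact ((ContinuousMap.norm_coe_le_norm _ x).trans (hv dV).le)

end ControlModel

/-! ### A uniform law of large numbers -/

/-- Membership in a closed ball of C(Θ) can be tested on a dense sequence, and by separability every
open set is a countable union of such balls. -/
theorem measurable_continuousMap_of_eval {S Θ : Type*} [MeasurableSpace S] [MetricSpace Θ]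
    [CompactSpace Θ] [MeasurableSpace C(Θ, ℝ)] [BorelSpace C(Θ, ℝ)] {G : S → C(Θ, ℝ)}
    (hG : ∀ ϑ, Measurable fun σ => G σ ϑ) : Measurable G := by
  rcases isEmpty_or_nonempty Θ with hΘ | hΘ
  · exact measurable_of_subsingleton_codomain G
  have hball (g : C(Θ, ℝ)) {ρ : ℝ} (hρ : 0 ≤ ρ) : MeasurableSet (G ⁻¹' Metric.closedBall g ρ) := by
    have e : G ⁻¹' Metric.closedBall g ρ = ⋂ n : ℕ,
        {σ | |G σ (TopologicalSpace.denseSeq Θ n) - g (TopologicalSpace.denseSeq Θ n)| ≤ ρ} := by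
      ext σ
      rw [Set.mem_preimage, Metric.mem_closedBall, ContinuousMap.dist_le hρ, Set.mem_iInter]
      refine ⟨fun h n => h _, fun h ϑ => ?_⟩
      have hcl : IsClosed {ϑ | |G σ ϑ - g ϑ| ≤ ρ} :=
        isClosed_le (by fun_prop) continuous_const
      exact hcl.closure_subset_iff.2 (Set.range_subset_iff.2 h)
        (TopologicalSpace.denseRange_denseSeq Θ ϑ)
    rw [e]
    exact MeasurableSet.iInter fun n =>
      measurableSet_le ((hG _).sub_const _).abs measurable_const
  refine measurable_of_isOpen fun U hU => ?_
  choose ρ hρ hsub using fun g : U => Metric.nhds_basis_closedBall.mem_iff.1 (hU.mem_nhds g.2)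
  obtain ⟨s, hs, hcov⟩ := TopologicalSpace.countable_cover_nhds
    (f := fun g : U => Subtype.val ⁻¹' Metric.closedBall g.1 (ρ g))
    fun g => continuous_subtype_val.continuousAt.preimage_mem_nhds
      (Metric.closedBall_mem_nhds _ (hρ g))
  have e : G ⁻¹' U = ⋃ g ∈ s, G ⁻¹' Metric.closedBall g.1 (ρ g) := by
    ext σ
    simp only [Set.mem_iUnion, Set.mem_preimage]
    constructor
    · intro h
      have : (⟨G σ, h⟩ : U) ∈ ⋃ g ∈ s, Subtype.val ⁻¹' Metric.closedBall g.1 (ρ g) :=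
        hcov ▸ Set.mem_univ _
      simpa only [Set.mem_iUnion, exists_prop, Set.mem_preimage] using this
    · rintro ⟨g, _, hg⟩
      exact hsub g hg
  rw [e]
  exact MeasurableSet.biUnion hs fun g _ => hball _ (hρ g).le

/-- This is the strong law for random elements of the Banach space C(Θ); norm convergence there is
uniformity in ϑ, and evaluation commutes with the Bochner integral. -/
theorem uniform_strong_law {S E Ω : Type*} [MeasurableSpace S] [MetricSpace E]
    [MeasurableSpace Ω] {P : Measure Ω} [IsProbabilityMeasure P] {s : ℕ → Ω → S}
    (hs : ∀ i, Measurable (s i)) (hind : iIndepFun s P) {ν : Measure S}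
    (hν : ∀ i, P.map (s i) = ν) {Θ : Set E} (hΘ : IsCompact Θ) {f : E → S → ℝ}
    (hf : ∀ ϑ ∈ Θ, Measurable (f ϑ)) (hfc : ∀ σ, ContinuousOn (fun ϑ => f ϑ σ) Θ) {B : ℝ}
    (hB : ∀ ϑ ∈ Θ, ∀ σ, |f ϑ σ| ≤ B) :
    ∀ᵐ ω ∂P, ∀ ε : ℝ, 0 < ε → ∀ᶠ M : ℕ in atTop, ∀ ϑ ∈ Θ,
      |(1 / (M : ℝ)) * ∑ i ∈ Finset.range M, f ϑ (s i ω) - ∫ σ, f ϑ σ ∂ν| ≤ ε := by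
  have : CompactSpace Θ := isCompact_iff_compactSpace.1 hΘ
  let _ : MeasurableSpace C(Θ, ℝ) := borel _
  have : BorelSpace C(Θ, ℝ) := ⟨rfl⟩
  let G (σ : S) : C(Θ, ℝ) := ⟨fun ϑ => f ϑ σ, (hfc σ).domRestrict⟩
  have hG : Measurable G := measurable_continuousMap_of_eval fun ϑ => hf ϑ ϑ.2
  have hint : Integrable (fun ω => G (s 0 ω)) P := by
    refine Integrable.of_bound (C := |B|) (hG.comp (hs 0)).aestronglyMeasurable
      (Eventually.of_forall fun ω => ?_)
    exact (ContinuousMap.norm_le _ (abs_nonneg B)).2 fun ϑ =>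
      (hB ϑ ϑ.2 _).trans (le_abs_self B)
  have h := strong_law_ae (μ := P) (fun i ω => G (s i ω)) hint
    (fun i j hij => (hind.indepFun hij).comp hG hG)
    (fun i => (IdentDistrib.mk (hs i).aemeasurable (hs 0).aemeasurable
      ((hν i).trans (hν 0).symm)).comp hG)
  filter_upwards [h] with ω hω ε hε
  filter_upwards [(Metric.tendsto_nhds.1 hω) ε hε] with M hM ϑ hϑ
  have h1 := (ContinuousMap.dist_apply_le_dist (⟨ϑ, hϑ⟩ : Θ)).trans hM.le
  have h2 : (∫ ω, G (s 0 ω) ∂P) ⟨ϑ, hϑ⟩ = ∫ σ, f ϑ σ ∂ν := by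
    have e := (ContinuousMap.evalCLM ℝ (⟨ϑ, hϑ⟩ : Θ)).integral_comp_comm hint
    rw [← hν 0, integral_map (hs 0).aemeasurable (hf ϑ hϑ).aestronglyMeasurable]
    exact e.symm
  have h3 : ((M : ℝ)⁻¹ • ∑ i ∈ Finset.range M, G (s i ω)) ⟨ϑ, hϑ⟩ =
      1 / (M : ℝ) * ∑ i ∈ Finset.range M, f ϑ (s i ω) := by
    rw [ContinuousMap.smul_apply, ContinuousMap.sum_apply, smul_eq_mul, one_div]; rfl
  rwa [h2, h3, Real.dist_eq] at h1

namespace ControlModel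

variable {nx na nl : ℕ} {C : ControlModel nx na nl}

/-! ### Empirical means -/

section EmpMean

variable {N : ℕ} (M : ℕ) (s : ℕ → Fin N → C.K)

theorem empMean_le_add {f g : C.K → ℝ} {b : ℝ} (hb : 0 ≤ b)
    (h : ∀ i t, f (s i t) ≤ g (s i t) + b) : C.empMean M s f ≤ C.empMean M s g + N * b := by
  have h1 : ∑ i ∈ Finset.range M, ∑ t, f (s i t) ≤
      ∑ i ∈ Finset.range M, ∑ t, g (s i t) + M * (N * b) := by
    calc _ ≤ ∑ i ∈ Finset.range M, ∑ t, (g (s i t) + b) :=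
          Finset.sum_le_sum fun i _ => Finset.sum_le_sum fun t _ => h i t
      _ = _ := by simp [Finset.sum_add_distrib]
  -- Only an inequality: for M = 0 the left side is 0, and b ≥ 0 is needed.
  have h2 : (1 / (M : ℝ)) * (M * (N * b)) ≤ N * b := by
    rcases Nat.eq_zero_or_pos M with rfl | hM
    · simp; positivity
    · have : (M : ℝ) ≠ 0 := by positivity
      rw [← mul_assoc, one_div_mul_cancel this, one_mul]
  have h3 := mul_le_mul_of_nonneg_left h1 (one_div_nonneg.2 (Nat.cast_nonneg (α := ℝ) M))
  rw [mul_add] at h3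
  exact h3.trans (by unfold empMean; linarith)

theorem objective_eq {d DV : ℕ} (L : C.LagrangeSystem d)
    (c : Coeffs (polyDim (nx + na) d) nl DV) :
    C.objective L M s c = C.empMean M s (C.polyψ L c) := by
  simp only [objective, polyψ, L.evalK_poly, empMean, Finset.mul_sum, Finset.sum_mul]
  rw [Finset.sum_comm]
  refine Finset.sum_congr rfl fun i _ => ?_
  rw [Finset.sum_comm]
  exact Finset.sum_congr rfl fun t _ => Finset.sum_congr rfl fun k _ => by ring

end EmpMean

/-! ### Polynomial and exact estimates -/

section Estimates

variable {d DV : ℕ} {L : C.LagrangeSystem d} {γ : Fin nl → Fin (polyDim (nx + na) d) → ℝ}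
  {r : Fin DV → MvPolynomial (Fin nx) ℝ}

/-- The polynomials r_j are interpolated exactly, so compared with the exact estimate only the
features and q*r_j carry an error. -/
theorem polyψ_apply {c : Coeffs (polyDim (nx + na) d) nl DV} (hr : ∀ j, (r j).totalDegree ≤ d)
    (hc : ∀ k, c.ψ k = ∑ i, c.ell i * γ i k +
      ∑ j, c.V j * (C.α * C.qStar (C.evalX (r j)) (L.node k) - C.evalX (r j) (L.node k).1))
    (z : C.K) : C.polyψ L c z = ∑ i, c.ell i * C.evalK (L.poly (γ i)) z +
      ∑ j, c.V j * (C.α * C.evalK (L.interp (C.qStar (C.evalX (r j)))) z -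
        C.evalX (r j) z.1) := by
  simp only [polyψ, L.evalK_poly, hc, add_mul, Finset.sum_add_distrib, Finset.sum_mul]
  congr 1
  · rw [Finset.sum_comm]
    refine Finset.sum_congr rfl fun i _ => ?_
    rw [Finset.mul_sum]
    exact Finset.sum_congr rfl fun k _ => by ring
  · rw [Finset.sum_comm]
    refine Finset.sum_congr rfl fun j _ => ?_
    rw [← L.evalK_interp_fst (hr j) z]
    simp only [LagrangeSystem.interp, L.evalK_poly]
    rw [Finset.mul_sum, ← Finset.sum_sub_distrib, Finset.mul_sum]
    exact Finset.sum_congr rfl fun k _ => by ring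

theorem exactψ_apply {Dψ : ℕ} (c : Coeffs Dψ nl DV) (z : C.K) :
    C.exactψ r c z = ∑ i, c.ell i * C.φ i z +
      ∑ j, c.V j * (C.α * C.qStar (C.evalX (r j)) z - C.evalX (r j) z.1) := by
  have h : C.qStar (fun x => ∑ j, c.V j * C.evalX (r j) x) z =
      ∑ j, c.V j * C.qStar (C.evalX (r j)) z := by
    rw [qStar, integral_finsetSum]
    · simp only [integral_const_mul, qStar]
    · exact fun j _ => (integrable_of_continuous (evalX_continuous (r j)) z).const_mul _
  rw [exactψ, h, add_sub_assoc, Finset.mul_sum, ← Finset.sum_sub_distrib]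
  congr 1
  exact Finset.sum_congr rfl fun j _ => by ring

theorem abs_le_of_sq_le {x β : ℝ} (h : x ^ 2 ≤ β) : |x| ≤ β + 1 := by
  rw [← sq_abs] at h
  nlinarith [sq_nonneg (|x| - 1), abs_nonneg x]

end Estimates

/-- With d_V fixed, the number of terms and the bounds on the coefficients do not depend on d_ψ, so
the two estimates agree uniformly over all admissible coefficients. -/
theorem eventually_polyψ_near {DV D : ℕ} {L : (dψ : ℕ) → C.LagrangeSystem (2 * dψ)}
    {γ : (dψ : ℕ) → Fin nl → Fin (polyDim (nx + na) (2 * dψ)) → ℝ}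
    {r : Fin DV → MvPolynomial (Fin nx) ℝ} (hr : ∀ j, (r j).totalDegree ≤ D)
    (hγ : ∀ i, TendstoUniformly (fun dψ => C.evalK ((L dψ).poly (γ dψ i))) (C.φ i) atTop)
    (hq : ∀ j, TendstoUniformly (fun dψ => C.evalK ((L dψ).interp (C.qStar (C.evalX (r j)))))
      (C.qStar (C.evalX (r j))) atTop) {βl βV : ℝ} (hβl : 0 ≤ βl) (hβV : 0 ≤ βV)
    {η : ℝ} (hη : 0 < η) :
    ∀ᶠ dψ : ℕ in atTop, ∀ c : Coeffs (polyDim (nx + na) (2 * dψ)) nl DV,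
      (∀ k, c.ψ k = ∑ i, c.ell i * γ dψ i k + ∑ j, c.V j *
        (C.α * C.qStar (C.evalX (r j)) ((L dψ).node k) - C.evalX (r j) ((L dψ).node k).1)) →
      (∀ i, c.ell i ^ 2 ≤ βl) → (∀ j, c.V j ^ 2 ≤ βV) →
      ∀ z, |C.polyψ (L dψ) c z - C.exactψ r c z| ≤ η := by
  set S : ℝ := nl * (βl + 1) + DV * (βV + 1)
  have hS : 0 ≤ S := by positivity
  have hδ : 0 < η / (S + 1) := by positivity
  have h1 := eventually_all.2 fun i => Metric.tendstoUniformly_iff.1 (hγ i) _ hδ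
  have h2 := eventually_all.2 fun j => Metric.tendstoUniformly_iff.1 (hq j) _ hδ
  filter_upwards [h1, h2, eventually_ge_atTop D] with dψ h1 h2 hD c hc hl hV z
  rw [polyψ_apply (fun j => (hr j).trans (by omega)) hc, exactψ_apply, add_sub_add_comm,
    ← Finset.sum_sub_distrib, ← Finset.sum_sub_distrib]
  have b1 : |∑ i, (c.ell i * C.evalK ((L dψ).poly (γ dψ i)) z - c.ell i * C.φ i z)| ≤
      nl * ((βl + 1) * (η / (S + 1))) := by
    refine (Finset.abs_sum_le_sum_abs _ _).trans ((Finset.sum_le_card_nsmul _ _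
      ((βl + 1) * (η / (S + 1))) fun i _ => ?_).trans (by simp))
    rw [← mul_sub, abs_mul]
    have := (h1 i z).le
    rw [dist_comm, Real.dist_eq] at this
    exact mul_le_mul (abs_le_of_sq_le (hl i)) this (abs_nonneg _) (by positivity)
  have b2 : |∑ j, (c.V j * (C.α * C.evalK ((L dψ).interp (C.qStar (C.evalX (r j)))) z -
      C.evalX (r j) z.1) - c.V j * (C.α * C.qStar (C.evalX (r j)) z - C.evalX (r j) z.1))| ≤
      DV * ((βV + 1) * (η / (S + 1))) := by
    refine (Finset.abs_sum_le_sum_abs _ _).trans ((Finset.sum_le_card_nsmul _ _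
      ((βV + 1) * (η / (S + 1))) fun j _ => ?_).trans (by simp))
    rw [← mul_sub, abs_mul, sub_sub_sub_cancel_right, ← mul_sub, abs_mul, abs_of_pos C.α_pos]
    have := (h2 j z).le
    rw [dist_comm, Real.dist_eq] at this
    refine mul_le_mul (abs_le_of_sq_le (hV j)) ?_ (by have := C.α_pos; positivity) (by positivity)
    exact (mul_le_of_le_one_left (abs_nonneg _) C.α_lt_one.le).trans this
  calc _ ≤ _ := abs_add_le _ _
    _ ≤ _ := add_le_add b1 b2
    _ = S * (η / (S + 1)) := by ring
    _ ≤ η := by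
      rw [mul_div_assoc', div_le_iff₀ (by positivity)]
      nlinarith

/-- Polynomials `V` whose defect `ℓ + α q*V - V` lies slightly above the true one. -/
theorem exists_upper_approximation (C : ControlModel nx na nl)
    {r : (dV : ℕ) → Fin (polyDim nx (2 * dV)) → MvPolynomial (Fin nx) ℝ}
    (hr : ∀ dV, IsPolyBasis (r dV)) :
    ∃ (v : (dV : ℕ) → Fin (polyDim nx (2 * dV)) → ℝ) (e : ℕ → ℝ), (∀ dV, 0 < e dV) ∧
      Tendsto e atTop (nhds 0) ∧
      ∀ dV (Dψ : ℕ) (c : Coeffs Dψ nl (polyDim nx (2 * dV))), c.ell = C.θ → c.V = v dV →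
        ∀ z, C.trueψ z + e dV ≤ C.exactψ (r dV) c z ∧
          C.exactψ (r dV) c z ≤ C.trueψ z + 5 * e dV := by
  obtain ⟨v, e, he, het, hv⟩ := exists_approximation ⟨C.value, continuous_value⟩ hr
  have h1 (dV) : (1 : MvPolynomial (Fin nx) ℝ).totalDegree ≤ 2 * dV := by simp
  choose w hw using fun dV => exists_coeff_eval (hr dV) (h1 dV)
  have hw' (dV) (x : C.X) : ∑ j, w dV j * C.evalX (r dV j) x = 1 := by
    rw [← evalX_sum, hw]; simp [evalX]
  have hα : 0 < 1 - C.α := sub_pos.2 C.α_lt_one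
  -- Lowering V by κ raises the defect by (1 - α)κ = 3e. The approximation error changes the defect
  -- by at most (1 + α)e ≤ 2e, hence the range from e to 5e.
  refine ⟨fun dV j => v dV j - 3 / (1 - C.α) * e dV * w dV j, e, he, het,
    fun dV Dψ c hl hV z => ?_⟩
  have hsum (x : C.X) : ∑ j, c.V j * C.evalX (r dV j) x =
      ∑ j, v dV j * C.evalX (r dV j) x - 3 / (1 - C.α) * e dV := by
    simp only [hV, sub_mul, Finset.sum_sub_distrib, mul_assoc, ← Finset.mul_sum, hw', mul_one]
  have hcont : Continuous fun x : C.X => ∑ j, v dV j * C.evalX (r dV j) x :=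
    continuous_finsetSum _ fun j _ => continuous_const.mul (evalX_continuous _)
  have hq : C.qStar (fun x => ∑ j, c.V j * C.evalX (r dV j) x) z =
      C.qStar (fun x => ∑ j, v dV j * C.evalX (r dV j) x) z - 3 / (1 - C.α) * e dV := by
    simp only [qStar, hsum]
    rw [integral_sub (integrable_of_continuous hcont z) (integrable_const _)]
    simp
  have hqd : |C.qStar (fun x => ∑ j, v dV j * C.evalX (r dV j) x) z - C.qStar C.value z| ≤
      e dV := by
    rw [qStar, qStar, ← integral_sub (integrable_of_continuous hcont z)
      (integrable_of_continuous continuous_value z)]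
    simpa using norm_integral_le_of_norm_le_const (μ := C.Q z) (C := e dV)
      (f := fun x => ∑ j, v dV j * C.evalX (r dV j) x - C.value x)
      (Eventually.of_forall fun x => hv dV x)
  have hvd := abs_le.1 (hv dV z.1)
  change _ ≤ _ - C.value z.1 ∧ _ - C.value z.1 ≤ _ at hvd
  have e3 : 3 / (1 - C.α) * e dV * (1 - C.α) = 3 * e dV := by field_simp
  have hαq := abs_le.1 hqd
  have hα1 : C.α * (C.qStar (fun x => ∑ j, v dV j * C.evalX (r dV j) x) z -
      C.qStar C.value z) ≤ e dV := by
    nlinarith [C.α_pos, C.α_lt_one, he dV]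
  have hα2 : -e dV ≤ C.α * (C.qStar (fun x => ∑ j, v dV j * C.evalX (r dV j) x) z -
      C.qStar C.value z) := by
    nlinarith [C.α_pos, C.α_lt_one, he dV]
  rw [exactψ, hq, hsum, trueψ, hl]
  change C.cost z + _ - _ + _ ≤ C.cost z + _ - _ ∧ C.cost z + _ - _ ≤ C.cost z + _ - _ + _
  constructor <;> nlinarith

/-! ### Lebesgue measure on the box -/

theorem comap_volume_univ {n : ℕ} (a b : Fin n → ℝ) :
    (Measure.comap Subtype.val (volume : Measure (Fin n → ℝ)) : Measure (Set.Icc a b)) Set.univ =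
      ∏ i, ENNReal.ofReal (b i - a i) := by
  rw [(MeasurableEmbedding.subtype_coe measurableSet_Icc).comap_apply, Set.image_univ,
    Subtype.range_coe, Real.volume_Icc_pi]

theorem isFiniteMeasure_comap_volume {n : ℕ} (a b : Fin n → ℝ) :
    IsFiniteMeasure (Measure.comap Subtype.val (volume : Measure (Fin n → ℝ)) :
      Measure (Set.Icc a b)) :=
  ⟨by rw [comap_volume_univ]; exact ENNReal.prod_lt_top fun _ _ => ENNReal.ofReal_lt_top⟩

instance : IsFiniteMeasure C.lebesgue := by
  have := isFiniteMeasure_comap_volume C.xmin C.xmax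
  have := isFiniteMeasure_comap_volume C.amin C.amax
  unfold lebesgue; infer_instance

theorem integrable_lebesgue {f : C.K → ℝ} (hf : Continuous f) : Integrable f C.lebesgue :=
  (BoundedContinuousFunction.mkOfCompact ⟨f, hf⟩).integrable _

/-- The rescaling in Putinar's theorem needs nondegenerate intervals; the normalization of ψ̄
provides them through this lemma. -/
theorem lt_of_lebesgue_ne_zero (h : C.lebesgue ≠ 0) :
    (∀ i, C.xmin i < C.xmax i) ∧ ∀ i, C.amin i < C.amax i := by
  have hz {n : ℕ} {a b : Fin n → ℝ} {i : Fin n} (hi : b i ≤ a i) :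
      (Measure.comap Subtype.val (volume : Measure (Fin n → ℝ)) : Measure (Set.Icc a b)) = 0 := by
    rw [← Measure.measure_univ_eq_zero, comap_volume_univ]
    exact Finset.prod_eq_zero (Finset.mem_univ i) (ENNReal.ofReal_eq_zero.2 (by linarith))
  constructor <;> intro i <;> by_contra hi <;> refine h ?_ <;> unfold lebesgue
  · rw [hz (not_lt.1 hi), Measure.zero_prod]
  · rw [hz (not_lt.1 hi), Measure.prod_zero]

/-! ### The quadratic module of the box -/

theorem isQuadModule_quadraticModule (C : ControlModel nx na nl) :
    IsQuadModule C.quadraticModule where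
  one_mem := ⟨1, 0, by simp,
    fun _ => IsSumSq.zero, by simp⟩
  add_mem := by
    rintro _ ⟨u₀, u, h₀, h, rfl⟩ _ ⟨v₀, v, k₀, k, rfl⟩
    refine ⟨u₀ + v₀, u + v, h₀.add k₀, fun i => (h i).add (k i), ?_⟩
    simp only [Pi.add_apply, add_mul, Finset.sum_add_distrib]; ring
  sq_mul_mem := by
    rintro s _ ⟨u₀, u, h₀, h, rfl⟩
    refine ⟨s * s * u₀, fun i => s * s * u i, (IsSumSq.mul_self s).mul h₀,
      fun i => (IsSumSq.mul_self s).mul (h i), ?_⟩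
    simp only [mul_add, Finset.mul_sum, mul_assoc]

theorem g_mem_quadraticModule (C : ControlModel nx na nl) (i) : C.g i ∈ C.quadraticModule := by
  classical
  refine ⟨0, Pi.single i 1, IsSumSq.zero, fun j => ?_, ?_⟩
  · by_cases h : j = i
    · subst h; simp
    · rw [Pi.single_eq_of_ne h]; exact IsSumSq.zero
  · simp [Pi.single_apply]

theorem mem_quadraticModule_of_pos (hx : ∀ i, C.xmin i < C.xmax i)
    (ha : ∀ i, C.amin i < C.amax i) {P : MvPolynomial (Fin nx ⊕ Fin na) ℝ} {c : ℝ} (hc : 0 < c)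
    (hP : ∀ z, c ≤ C.evalK P z) : P ∈ C.quadraticModule := by
  refine mem_quadModule_of_pos (Sum.elim C.xmin C.amin) (Sum.elim C.xmax C.amax)
    (by rintro (i | i) <;> simp [hx, ha]) C.isQuadModule_quadraticModule
    (by
      rintro (i | i)
      · exact C.g_mem_quadraticModule (.inl i)
      · exact C.g_mem_quadraticModule (.inr i)) P hc fun y hy => ?_
  have := hP (⟨fun i => y (.inl i), fun i => hy.1 (.inl i), fun i => hy.2 (.inl i)⟩,
    ⟨fun i => y (.inr i), fun i => hy.1 (.inr i), fun i => hy.2 (.inr i)⟩)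
  convert this using 1
  simp only [evalK]
  congr 2
  funext i
  cases i <;> rfl

theorem evalK_nonneg_of_mem {P : MvPolynomial (Fin nx ⊕ Fin na) ℝ} (hP : P ∈ C.quadraticModule)
    (z : C.K) : 0 ≤ C.evalK P z := by
  obtain ⟨u₀, u, h₀, h, rfl⟩ := hP
  have hs {q : MvPolynomial (Fin nx ⊕ Fin na) ℝ} (hq : IsSumSq q) : 0 ≤ C.evalK q z := by
    induction hq with
    | zero => simp [evalK]
    | sq_add a _ ih => simpa [evalK] using add_nonneg (mul_self_nonneg _) ih
  have hg (i) : 0 ≤ C.evalK (C.g i) z := by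
    cases i with
    | inl i =>
      simpa [evalK, g] using mul_nonneg (sub_nonneg.2 (z.1.2.1 i)) (sub_nonneg.2 (z.1.2.2 i))
    | inr i =>
      simpa [evalK, g] using mul_nonneg (sub_nonneg.2 (z.2.2.1 i)) (sub_nonneg.2 (z.2.2.2 i))
  have e : C.evalK (u₀ + ∑ i, u i * C.g i) z =
      C.evalK u₀ z + ∑ i, C.evalK (u i) z * C.evalK (C.g i) z := by
    simp only [evalK, map_add, map_sum, map_mul]
  rw [e]
  exact add_nonneg (hs h₀) (Finset.sum_nonneg fun i _ => mul_nonneg (hs (h i)) (hg i))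

/-! ### Consistency -/

theorem sqDist_comm {n : ℕ} (u v : Fin n → ℝ) : sqDist u v = sqDist v u :=
  Finset.sum_congr rfl fun _ _ => by ring

/-- The true cost coefficients with the lowered approximate value function work: since η ≤ e/2, the
polynomial exceeds ψ̄ by at least e/2, which gives both membership in the quadratic module and the
integral constraint. -/
theorem exists_feasible (hnorm : 1 ≤ ∫ z, C.trueψ z ∂C.lebesgue) {DV D : ℕ}
    {L : (dψ : ℕ) → C.LagrangeSystem (2 * dψ)}
    {γ : (dψ : ℕ) → Fin nl → Fin (polyDim (nx + na) (2 * dψ)) → ℝ}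
    {r : Fin DV → MvPolynomial (Fin nx) ℝ} (hr : ∀ j, (r j).totalDegree ≤ D)
    (hγ : ∀ i, TendstoUniformly (fun dψ => C.evalK ((L dψ).poly (γ dψ i))) (C.φ i) atTop)
    (hq : ∀ j, TendstoUniformly (fun dψ => C.evalK ((L dψ).interp (C.qStar (C.evalX (r j)))))
      (C.qStar (C.evalX (r j))) atTop) {βψ βl βV : ℝ} {v : Fin DV → ℝ} {e η B : ℝ} (he : 0 < e)
    (hv : ∀ (Dψ : ℕ) (c : Coeffs Dψ nl DV), c.ell = C.θ → c.V = v → ∀ z,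
      C.trueψ z + e ≤ C.exactψ r c z ∧ C.exactψ r c z ≤ C.trueψ z + 5 * e)
    (hη : 0 < η) (hηe : η ≤ e / 2) (heη : 5 * e + η ≤ 1) (hB : ∀ z, |C.trueψ z| ≤ B)
    (hβψ : (B + 1) ^ 2 ≤ βψ) (hβl : ∑ i, C.θ i ^ 2 ≤ βl) (hβV : ∑ j, v j ^ 2 ≤ βV) :
    ∀ᶠ dψ : ℕ in atTop, ∃ c ∈ C.feasible (L dψ) (γ dψ) r βψ βl βV,
      ∀ z, C.polyψ (L dψ) c z ≤ C.trueψ z + (5 * e + η) := by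
  have hne : C.lebesgue ≠ 0 := by
    intro h
    rw [h, integral_zero_measure] at hnorm
    linarith
  obtain ⟨hx, ha⟩ := lt_of_lebesgue_ne_zero hne
  have hl0 : ∀ i, C.θ i ^ 2 ≤ βl := fun i =>
    (Finset.single_le_sum (f := fun i => C.θ i ^ 2) (fun i _ => sq_nonneg _)
      (Finset.mem_univ i)).trans hβl
  have hV0 : ∀ j, v j ^ 2 ≤ βV := fun j =>
    (Finset.single_le_sum (f := fun j => v j ^ 2) (fun i _ => sq_nonneg _)
      (Finset.mem_univ j)).trans hβV
  have h1 := eventually_polyψ_near hr hγ hq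
    ((Finset.sum_nonneg fun i _ => sq_nonneg (C.θ i)).trans hβl)
    ((Finset.sum_nonneg fun i _ => sq_nonneg (v i)).trans hβV) hη
  filter_upwards [h1] with dψ h1
  let c : Coeffs (polyDim (nx + na) (2 * dψ)) nl DV :=
    { ψ := fun k => ∑ i, C.θ i * γ dψ i k + ∑ j, v j *
        (C.α * C.qStar (C.evalX (r j)) ((L dψ).node k) - C.evalX (r j) ((L dψ).node k).1)
      ell := C.θ
      V := v }
  have hnear := fun z => abs_le.1 (h1 c (fun k => rfl) hl0 hV0 z)
  have hex := hv _ c rfl rfl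
  have hup (z) : C.polyψ (L dψ) c z ≤ C.trueψ z + (5 * e + η) := by
    linarith [(hnear z).2, (hex z).2]
  have hlow (z) : C.trueψ z + e / 2 ≤ C.polyψ (L dψ) c z := by
    linarith [(hnear z).1, (hex z).1]
  refine ⟨c, ⟨fun k => rfl, ?_, ?_, fun k => ?_, hl0, hV0⟩, hup⟩
  · exact mem_quadraticModule_of_pos hx ha (half_pos he) fun z => by
      have := hlow z
      have := trueψ_nonneg z
      change _ ≤ C.polyψ (L dψ) c z
      linarith
  · have e1 : ∑ k, c.ψ k * ∫ z, C.evalK ((L dψ).basis k) z ∂C.lebesgue =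
        ∫ z, C.polyψ (L dψ) c z ∂C.lebesgue := by
      simp only [polyψ, (L dψ).evalK_poly]
      rw [integral_finsetSum _ fun k _ =>
        (integrable_lebesgue (evalK_continuous ((L dψ).basis k))).const_mul _]
      simp only [integral_const_mul]
    rw [e1]
    refine hnorm.trans (integral_mono (integrable_lebesgue continuous_trueψ)
      (integrable_lebesgue (evalK_continuous _)) fun z => ?_)
    have := hlow z
    linarith
  -- Lagrange coordinates are nodal values, hence between 0 and B + 1 whatever d_ψ is.
  · have e1 : c.ψ k = C.polyψ (L dψ) c ((L dψ).node k) := ((L dψ).evalK_poly_node c.ψ k).symm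
    have h2 := hup ((L dψ).node k)
    have h3 := hlow ((L dψ).node k)
    have h4 := trueψ_nonneg ((L dψ).node k)
    have h5 := abs_le.1 (hB ((L dψ).node k))
    rw [e1]
    refine (pow_le_pow_left₀ ?_ ?_ 2).trans hβψ <;> linarith

/-- Two comparisons: c against the competitor c₀ in (E), and ϑ against the expert parameter in (P).
Each costs τ. Each passage between ψhat and the polynomial estimate costs at most η per observation:
once from above at the expert actions, once from below at the actions of π ϑ. -/
theorem empMean_sqDist_le {N d DV p : ℕ} {M : ℕ} {s : ℕ → Fin N → C.K} {πbar : C.X → C.A}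
    (hs : ∀ i t, C.trueψ (s i t) = 0) (hs' : ∀ i t, (s i t).2 = πbar (s i t).1)
    {L : C.LagrangeSystem d} {F : Set (Coeffs (polyDim (nx + na) d) nl DV)}
    {r : Fin DV → MvPolynomial (Fin nx) ℝ} {c₀ c : Coeffs (polyDim (nx + na) d) nl DV} {τ b η : ℝ}
    (hb : 0 ≤ b) (hη : 0 ≤ η) (hc₀ : c₀ ∈ F) (hc₀b : ∀ z, C.polyψ L c₀ z ≤ C.trueψ z + b)
    (hc : IsMinimizerUpTo τ (C.objective L M s) F c) (hcn : ∀ z, 0 ≤ C.polyψ L c z)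
    (hce : ∀ z, |C.polyψ L c z - C.exactψ r c z| ≤ η) {ψhat : C.K → ℝ}
    (hψ : ψhat = C.polyψ L c ∨ ψhat = C.exactψ r c) {Θ : Set (EuclideanSpace ℝ (Fin p))}
    {π : EuclideanSpace ℝ (Fin p) → C.X → C.A} (hπ : ∃ ϑ ∈ Θ, π ϑ = πbar)
    {ϑ : EuclideanSpace ℝ (Fin p)}
    (hϑ : IsMinimizerUpTo τ (fun ϑ => C.policyCriterion M s ψhat (π ϑ)) Θ ϑ) :
    C.empMean M s (fun z => sqDist (π ϑ z.1).1 (πbar z.1).1) ≤ 2 * τ + N * b + 2 * (N * η) := by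
  obtain ⟨ϑ₀, hϑ₀, rfl⟩ := hπ
  have h1 : C.empMean M s (C.polyψ L c) ≤ N * b + τ := by
    have h2 := hc.2 c₀ hc₀
    rw [objective_eq, objective_eq] at h2
    have h3 := empMean_le_add M s hb (f := C.polyψ L c₀) (g := fun _ => 0) fun i t => by
      simpa [hs] using hc₀b (s i t)
    have h4 : C.empMean M s (fun _ => 0) = 0 := by simp [empMean]
    linarith
  have hlow (z) : -η ≤ ψhat z := by
    rcases hψ with rfl | rfl
    · linarith [hcn z]
    · linarith [hcn z, (abs_le.1 (hce z)).2]
  have hup (z) : ψhat z ≤ C.polyψ L c z + η := by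
    rcases hψ with rfl | rfl
    · linarith
    · linarith [(abs_le.1 (hce z)).1]
  have h2 : C.policyCriterion M s ψhat (π ϑ₀) ≤ C.empMean M s (C.polyψ L c) + N * η := by
    refine empMean_le_add M s hη fun i t => ?_
    rw [← hs' i t]
    have : sqDist (s i t).2.1 (s i t).2.1 = 0 := by simp [sqDist]
    rw [this, add_zero]
    exact hup _
  have h3 : C.empMean M s (fun z => sqDist (π ϑ z.1).1 (π ϑ₀ z.1).1) ≤
      C.policyCriterion M s ψhat (π ϑ) + N * η := by
    refine empMean_le_add M s hη fun i t => ?_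
    rw [← hs' i t, sqDist_comm]
    linarith [hlow ((s i t).1, π ϑ (s i t).1)]
  have h4 := hϑ.2 ϑ₀ hϑ₀
  dsimp only at h4
  linarith

theorem integral_occupation {p : C.Policy} {μ : Measure C.X} [IsProbabilityMeasure μ] {N : ℕ}
    {g : C.X → ℝ} (hg : Measurable g) {B : ℝ} (hB : ∀ x, |g x| ≤ B) :
    ∫ x, g x ∂((p.occupation μ N).map Prod.fst) =
      ∫ σ, ∑ t, g (σ t).1 ∂((p.law μ).map fun η (t : Fin N) => η t) := by
  have hint (t : ℕ) : Integrable (fun η : ℕ → C.K => g (η t).1) (p.law μ) :=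
    Integrable.of_bound (C := B)
      (hg.comp (measurable_fst.comp (measurable_pi_apply t))).aestronglyMeasurable
      (Eventually.of_forall fun η => hB _)
  have hgK : Measurable fun z : C.K => g z.1 := hg.comp measurable_fst
  have hmap (t : ℕ) : Integrable (fun z : C.K => g z.1) ((p.law μ).map fun η => η t) :=
    (integrable_map_measure hgK.aestronglyMeasurable (measurable_pi_apply t).aemeasurable).2 (hint t)
  have hr : Measurable fun (η : ℕ → C.K) (t : Fin N) => η t :=
    measurable_pi_lambda _ fun t => measurable_pi_apply _
  have hsum : Measurable fun σ : Fin N → C.K => ∑ t, g (σ t).1 :=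
    Finset.measurable_sum _ fun t _ => hgK.comp (measurable_pi_apply t)
  rw [integral_map measurable_fst.aemeasurable hg.aestronglyMeasurable, Policy.occupation,
    integral_finsetSum_measure fun t _ => hmap t,
    integral_map hr.aemeasurable hsum.aestronglyMeasurable,
    Finset.sum_range fun t => ∫ z : C.K, g z.1 ∂((p.law μ).map fun η => η t)]
  refine Eq.trans ?_ (integral_finsetSum Finset.univ fun (t : Fin N) _ => hint t).symm
  exact Finset.sum_congr rfl fun t _ =>
    integral_map (measurable_pi_apply _).aemeasurable hgK.aestronglyMeasurable

theorem ae_empMean_sqDist_near {p : C.Policy} {μ : Measure C.X} [IsProbabilityMeasure μ] {N : ℕ}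
    {Ω : Type*} [MeasurableSpace Ω] {P : Measure Ω} [IsProbabilityMeasure P]
    {s : ℕ → Ω → Fin N → C.K} (hs : ∀ i, Measurable (s i)) (hind : iIndepFun s P)
    (hlaw : ∀ i, P.map (s i) = (p.law μ).map fun η (t : Fin N) => η t) {E : Type*} [MetricSpace E]
    {Θ : Set E} (hΘ : IsCompact Θ) {π : E → C.X → C.A} (hπ : ∀ ϑ ∈ Θ, Measurable (π ϑ))
    (hπc : ∀ x, ContinuousOn (fun ϑ => π ϑ x) Θ) {πbar : C.X → C.A} (hπbar : Measurable πbar) :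
    ∀ᵐ ω ∂P, ∀ ε : ℝ, 0 < ε → ∀ᶠ M : ℕ in atTop, ∀ ϑ ∈ Θ,
      |C.empMean M (fun i => s i ω) (fun z => sqDist (π ϑ z.1).1 (πbar z.1).1) -
        ∫ x, sqDist (π ϑ x).1 (πbar x).1 ∂((p.occupation μ N).map Prod.fst)| ≤ ε := by
  obtain ⟨D, hD, hdc⟩ : ∃ D : C.A × C.A → ℝ,
      (∀ u w, D (u, w) = sqDist u.1 w.1) ∧ Continuous D :=
    ⟨fun q => sqDist q.1.1 q.2.1, fun _ _ => rfl,
      continuous_sqDist.comp ((continuous_subtype_val.comp continuous_fst).prodMk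
        (continuous_subtype_val.comp continuous_snd))⟩
  simp only [← hD]
  obtain ⟨B, hB⟩ : ∃ B, ∀ q, |D q| ≤ B := ⟨_, (⟨D, hdc⟩ : C(C.A × C.A, ℝ)).norm_coe_le_norm⟩
  have hg (ϑ) (hϑ : ϑ ∈ Θ) : Measurable fun x => D (π ϑ x, πbar x) :=
    hdc.measurable.comp ((hπ ϑ hϑ).prodMk hπbar)
  have h := uniform_strong_law hs hind hlaw hΘ
    (f := fun ϑ σ => ∑ t, D (π ϑ (σ t).1, πbar (σ t).1)) (B := N * B)
    (fun ϑ hϑ => Finset.measurable_sum _ fun t _ =>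
      (hg ϑ hϑ).comp (measurable_fst.comp (measurable_pi_apply t)))
    (fun σ => continuousOn_finsetSum _ fun t _ =>
      hdc.comp_continuousOn ((hπc (σ t).1).prodMk continuousOn_const))
    (fun ϑ _ σ => (Finset.abs_sum_le_sum_abs _ _).trans
      ((Finset.sum_le_card_nsmul _ _ B fun t _ => hB _).trans (by simp)))
  filter_upwards [h] with ω hω ε hε
  filter_upwards [hω ε hε] with M hM ϑ hϑ
  rw [integral_occupation (hg ϑ hϑ) fun x => hB _]
  exact hM ϑ hϑ

end ControlModel

end IOC

/-! ### Assembly of the estimates. -/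

open IOC ControlModel in
theorem corollary4p8 {nx na nl : ℕ} (C : IOC.ControlModel nx na nl)
    -- the initial distribution has full support
    (μ₁ : Measure C.X) [IsProbabilityMeasure μ₁] (hμ₁ : μ₁.support = Set.univ)
    -- the expert uses an optimal deterministic stationary policy
    (πbar : C.X → C.A) (hπbar : Measurable πbar) (hopt : (C.stationary πbar hπbar).IsOptimal μ₁)
    -- normalization of the true running cost and the true value function
    (hnorm : 1 ≤ ∫ z, C.trueψ z ∂C.lebesgue)
    -- polynomial bases for the approximation of the value function
    (r : (dV : ℕ) → Fin (IOC.polyDim nx (2 * dV)) → MvPolynomial (Fin nx) ℝ)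
    (hr : ∀ dV, IOC.IsPolyBasis (r dV)) :
    -- the coefficient bounds are large enough
    ∃ (bψ bl : ℝ) (bV : ℕ → ℝ), ∀ (βψ βl : ℝ) (βV : ℕ → ℝ),
    bψ ≤ βψ → bl ≤ βl → (∀ dV, bV dV ≤ βV dV) →
    -- polynomial approximations on `X × A` that converge as `dψ → ∞`
    ∀ (L : (dV dψ : ℕ) → C.LagrangeSystem (2 * dψ))
      (γ : (dV dψ : ℕ) → Fin nl → Fin (IOC.polyDim (nx + na) (2 * dψ)) → ℝ),
    (∀ dV i, TendstoUniformly (fun dψ => C.evalK ((L dV dψ).poly (γ dV dψ i))) (C.φ i) atTop) →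
    (∀ dV j, TendstoUniformly
      (fun dψ => C.evalK ((L dV dψ).interp (C.qStar (C.evalX (r dV j)))))
      (C.qStar (C.evalX (r dV j))) atTop) →
    -- the i.i.d. expert trajectories, observed at the first `N` times
    ∀ (N : ℕ) {Ω : Type*} [MeasurableSpace Ω] (P : Measure Ω) [IsProbabilityMeasure P]
      (s : ℕ → Ω → Fin N → C.K),
    (∀ i, Measurable (s i)) → iIndepFun s P →
    (∀ i, P.map (s i) = ((C.stationary πbar hπbar).law μ₁).map (fun η (t : Fin N) => η t)) →
    -- the parametrized policies
    ∀ (p : ℕ) (Θ : Set (EuclideanSpace ℝ (Fin p))) (π : EuclideanSpace ℝ (Fin p) → C.X → C.A),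
    IsCompact Θ → (∀ ϑ ∈ Θ, Measurable (π ϑ)) → (∀ x, ContinuousOn (fun ϑ => π ϑ x) Θ) →
    (∃ ϑ ∈ Θ, π ϑ = πbar) →
    -- consistency, almost surely
    ∀ᵐ ω ∂P, ∀ ε : ℝ, 0 < ε → ∃ τ : ℝ, 0 < τ ∧
      ∀ᶠ M : ℕ in atTop, ∀ᶠ dV : ℕ in atTop, ∀ᶠ dψ : ℕ in atTop,
        (C.feasible (L dV dψ) (γ dV dψ) (r dV) βψ βl (βV dV)).Nonempty ∧
        ∀ c, IOC.IsMinimizerUpTo τ (C.objective (L dV dψ) M (fun i => s i ω))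
            (C.feasible (L dV dψ) (γ dV dψ) (r dV) βψ βl (βV dV)) c →
          ∀ ψhat : C.K → ℝ, (ψhat = C.polyψ (L dV dψ) c ∨ ψhat = C.exactψ (r dV) c) →
          ∀ ϑhat, IOC.IsMinimizerUpTo τ
              (fun ϑ => C.policyCriterion M (fun i => s i ω) ψhat (π ϑ)) Θ ϑhat →
            ∫ x, IOC.sqDist (π ϑhat x).1 (πbar x).1
              ∂(((C.stationary πbar hπbar).occupation μ₁ N).map Prod.fst) ≤ ε := by
  obtain ⟨v, e, he, het, hv⟩ := C.exists_upper_approximation hr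
  obtain ⟨B, hB⟩ : ∃ B, ∀ z, |C.trueψ z| ≤ B :=
    ⟨_, fun z => (⟨_, continuous_trueψ⟩ : C(C.K, ℝ)).norm_coe_le_norm z⟩
  refine ⟨(B + 1) ^ 2, ∑ i, C.θ i ^ 2, fun dV => ∑ j, v dV j ^ 2,
    fun βψ βl βV hβψ hβl hβV L γ hγ hq N Ω _ P _ s hs hind hlaw p Θ π hΘ hπ hπc hπe => ?_⟩
  have hrdeg (dV) (j) : (r dV j).totalDegree ≤ 2 * dV :=
    (MvPolynomial.mem_restrictTotalDegree _ _ _).1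
      ((hr dV).2 ▸ Submodule.subset_span (Set.mem_range_self j))
  have hmeasr : Measurable fun (η : ℕ → C.K) (t : Fin N) => η t :=
    measurable_pi_lambda _ fun t => measurable_pi_apply _
  have hdata (i : ℕ) : ∀ᵐ ω ∂P, ∀ t, C.trueψ (s i ω t) = 0 ∧ (s i ω t).2 = πbar (s i ω t).1 := by
    refine ae_of_ae_map (p := fun σ : Fin N → C.K =>
      ∀ t, C.trueψ (σ t) = 0 ∧ (σ t).2 = πbar (σ t).1) (hs i).aemeasurable ?_
    have hS : MeasurableSet {σ : Fin N → C.K |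
        ∀ t, C.trueψ (σ t) = 0 ∧ (σ t).2 = πbar (σ t).1} := by
      have hz : MeasurableSet {z : C.K | C.trueψ z = 0 ∧ z.2 = πbar z.1} :=
        (measurableSet_eq_fun continuous_trueψ.measurable measurable_const).inter
          (measurableSet_eq_fun measurable_snd (hπbar.comp measurable_fst))
      have : {σ : Fin N → C.K | ∀ t, C.trueψ (σ t) = 0 ∧ (σ t).2 = πbar (σ t).1} =
          ⋂ t, (fun σ : Fin N → C.K => σ t) ⁻¹' {z | C.trueψ z = 0 ∧ z.2 = πbar z.1} := by
        ext σ; simp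
      rw [this]
      exact MeasurableSet.iInter fun t => measurable_pi_apply t hz
    rw [hlaw i, ae_map_iff hmeasr.aemeasurable hS]
    refine ae_all_iff.2 fun t => ?_
    filter_upwards [trueψ_ae_eq_zero hopt t, stationary_ae πbar hπbar μ₁ t] with η h1 h2
    exact ⟨h1, h2⟩
  filter_upwards [ae_all_iff.2 hdata, ae_empMean_sqDist_near hs hind hlaw hΘ hπ hπc hπbar] with
    ω hω hulln ε hε
  have hτ : 0 < ε / 8 := by positivity
  -- Error budget: ε/2 from the law of large numbers, 2τ = ε/4, and ε/8 each from the competitor and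
  -- from interpolation.
  refine ⟨ε / 8, hτ, ?_⟩
  filter_upwards [hulln (ε / 2) (half_pos hε)] with M hM
  have hsmall : ∀ᶠ dV in atTop, 6 * e dV ≤ 1 ∧ N * (6 * e dV) ≤ ε / 8 := by
    have h6 : Tendsto (fun dV => 6 * e dV) atTop (nhds 0) := by simpa using het.const_mul 6
    have hN6 : Tendsto (fun dV => N * (6 * e dV)) atTop (nhds 0) := by
      simpa using h6.const_mul (N : ℝ)
    exact (h6.eventually (ge_mem_nhds one_pos)).and (hN6.eventually (ge_mem_nhds hτ))
  filter_upwards [hsmall] with dV hdV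
  obtain ⟨hdV1, hdV2⟩ := hdV
  have hedV := he dV
  -- The first bound keeps the competitor positive and gives 5e + η ≤ 6e; the second makes 2Nη ≤
  -- ε/8, also when N = 0.
  set η := min (e dV / 2) (ε / 8 / (2 * N + 1)) with hη_def
  have hη : 0 < η := lt_min (by positivity) (by positivity)
  have hη1 : η ≤ e dV / 2 := min_le_left _ _
  have hη2 : 2 * (N * η) ≤ ε / 8 := by
    have h := min_le_right (e dV / 2) (ε / 8 / (2 * N + 1))
    rw [← hη_def, le_div_iff₀ (by positivity)] at h
    linarith
  have hfeas := exists_feasible hnorm (hrdeg dV) (hγ dV) (hq dV) hedV (hv dV) hη hη1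
    (by linarith) hB hβψ hβl (hβV dV)
  have hnear := eventually_polyψ_near (hrdeg dV) (hγ dV) (hq dV)
    ((Finset.sum_nonneg fun i _ => sq_nonneg (C.θ i)).trans hβl)
    ((Finset.sum_nonneg fun i _ => sq_nonneg (v dV i)).trans (hβV dV)) hη
  filter_upwards [hfeas, hnear] with dψ hfeas hnear
  obtain ⟨c₀, hc₀, hc₀b⟩ := hfeas
  refine ⟨⟨c₀, hc₀⟩, fun c hc ψhat hψ ϑ hϑ => ?_⟩
  obtain ⟨hc1, hc2, -, -, hc5, hc6⟩ := hc.1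
  have h := empMean_sqDist_le (fun i t => (hω i t).1) (fun i t => (hω i t).2)
    (by positivity) hη.le hc₀ hc₀b hc (fun z => evalK_nonneg_of_mem hc2 z)
    (hnear c hc1 hc5 hc6) hψ hπe hϑ
  have h2 := abs_le.1 (hM ϑ hϑ.1)
  have h3 : (N : ℝ) * (5 * e dV + η) ≤ N * (6 * e dV) :=
    mul_le_mul_of_nonneg_left (by linarith) (Nat.cast_nonneg N)
  linarith [h2.1]
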